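/- Let $N\ge 1$. A Bernoulli hierarchical causal bandit (HCB) with parameters $(\alpha,\mathbf p,\mathbf q,r)$, where $\alpha\in(0,1)$, $\mathbf p,\mathbf q\in(0,1)^N$ and $r:\{0,1\}^N\to[0,1]$, consists of binary variables $S$ (context), $X_1,\dots,X_N$ (arms) and $Y$ (reward) with joint law $$P(S=s,\mathbf X=\mathbf x,Y=y)=P(S=s)\Big(\prod_{n=1}^N P(X_n=x_n\mid S=s)\Big)P(Y=y\mid \mathbf X=\mathbf x),$$ $P(S=1)=\alpha$, $P(X_n=1\mid S=1)=p_n$, $P(X_n=1\mid S=0)=q_n$, $P(Y=1\mid\mathbf X=\mathbf x)=r(\mathbf x)$. The intervention $\mathsf{do}(Z=z)$ on a variable $Z\in\{S,X_1,\dots,X_N\}$ replaces the factor of $Z$ by $\mathbf 1\{Z=z\}$; the empty intervention $\mathsf{do}(\varnothing)$ changes nothing. If the context is non-manipulable, the action set is $\mathcal A^{\mathsf{nmc}}=\{\mathsf{do}(\varnothing)\}\cup\{\mathsf{do}(X_n=x): 1\le n\le N,\ x\in\{0,1\}\}$; if it is manipulable, it is $\mathcal A^{\mathsf{mc}}=\mathcal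 A^{\mathsf{nmc}}\cup\{\mathsf{do}(S=0),\mathsf{do}(S=1)\}$. Write $\mu_a=E[Y\mid a]$ for the expected reward under the action $a$. An algorithm with horizon $T$ and action set $\mathcal A$ is a family of measurable maps $g^{(t)}:(\{0,1\}\times\{0,1\}^N\times\{0,1\}\times\mathcal A)^{t-1}\times[0,1]\to\mathcal A$, $1\le t\le T+1$; it does not depend on $(\alpha,\mathbf p,\mathbf q,r)$. In round $t\le T$ the action is $A^{(t)}=g^{(t)}(\mathbf H_{t-1},W^{(t)})$, where $\mathbf H_{t-1}$ is the history of the values of $(S,\mathbf X,Y,A)$ in the previous rounds and $W^{(1)},\dots,W^{(T+1)}$ are i.i.d. uniform on $[0,1]$, and then $(S,\mathbf X,Y)$ is drawn afresh from the law under $A^{(t)}$. The action $\hat A_T=g^{(T+1)}(\mathbf H_T,W^{(T+1)})$ is recommended. Its simple regret is $R_T=\max_{a\in\mathcal A}\mu_a-\sum_{a\in\mathcal A}\mu_a P(\hat A_T=a)$. For $\mathbf v\in(0,1)^N$ let $$m(\mathbf v)=\min\Big\{s>0:\ s\ge\big|\{n:\min\{v_n,1-v_n\}<1/s\}\big|\Big\}.$$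 Theorem. Let $N\ge1$ and $T\ge 2$. There is an algorithm with horizon $T$ for the non-manipulable context, i.e. with action set $\mathcal A^{\mathsf{nmc}}$, such that $$R_T\le 122\sqrt{\big(m(\mathbf p)\,\alpha+m(\mathbf q)(1-\alpha)\big)\frac{\log(NT)}{T}}$$ for all parameters $(\alpha,\mathbf p,\mathbf q,r)$ with $T>540\max\big\{\tfrac{m(\mathbf p)}{\alpha},\tfrac{m(\mathbf q)}{1-\alpha}\big\}\log(NT)$. Likewise, there is an algorithm with horizon $T$ for the manipulable context, i.e. with action set $\mathcal A^{\mathsf{mc}}$, such that $$R_T\le 116\sqrt{\big(m(\mathbf p)\,\alpha+m(\mathbf q)(1-\alpha)\big)\frac{\log(NT)}{T}}$$ for all parameters $(\alpha,\mathbf p,\mathbf q,r)$ with $T>540\max\big\{\tfrac{m(\mathbf p)}{\alpha},\tfrac{m(\mathbf q)}{1-\alpha}\big\}\log(NT)$. -/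

import Mathlib

open MeasureTheory

noncomputable section

namespace HCB

/-- The indices `n` for which `min (v n) (1 - v n) < 1 / s`. -/
def biasedSet {N : ℕ} (v : Fin N → ℝ) (s : ℝ) : Finset (Fin N) :=
  Finset.univ.filter fun n => min (v n) (1 - v n) < 1 / s

/-- The difficulty measure `m(v) = min {s > 0 : s ≥ |I_s(v)|}`, where `I_s(v) = biasedSet v s`.
The minimum is attained as soon as `N ≥ 1`, see `isLeast_difficulty`. -/
def difficulty {N : ℕ} (v : Fin N → ℝ) : ℝ :=
  sInf {s : ℝ | 0 < s ∧ ((biasedSet v s).card : ℝ) ≤ s}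

theorem isLeast_difficulty {N : ℕ} (hN : 1 ≤ N) (v : Fin N → ℝ) :
    IsLeast {s : ℝ | 0 < s ∧ ((biasedSet v s).card : ℝ) ≤ s} (difficulty v) := by
  set A : Set ℝ := {s : ℝ | 0 < s ∧ ((biasedSet v s).card : ℝ) ≤ s} with hA
  have hone : ∀ s ∈ A, (1 : ℝ) ≤ s := by
    rintro s ⟨hs, hc⟩
    by_contra! h
    have hinv : 1 < 1 / s := by rw [lt_div_iff₀ hs]; linarith
    have huniv : biasedSet v s = Finset.univ := by
      ext n
      simp only [biasedSet, Finset.mem_filter, Finset.mem_univ, true_and, iff_true]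
      rcases le_total (v n) (1 - v n) with h1 | h1
      · rw [min_eq_left h1]; linarith
      · rw [min_eq_right h1]; linarith
    rw [huniv, Finset.card_univ, Fintype.card_fin] at hc
    have : (1 : ℝ) ≤ N := by exact_mod_cast hN
    linarith
  have hbdd : BddBelow A := ⟨1, hone⟩
  have hne : A.Nonempty := by
    refine ⟨N, by exact_mod_cast hN, ?_⟩
    have := Finset.card_le_univ (biasedSet v (N : ℝ))
    rw [Fintype.card_fin] at this
    exact_mod_cast this
  have hpos : (0 : ℝ) < sInf A := lt_of_lt_of_le one_pos (le_csInf hne hone)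
  refine ⟨⟨hpos, ?_⟩, fun s hs => csInf_le hbdd hs⟩
  obtain ⟨u, -, hu, huA⟩ := exists_seq_tendsto_sInf hne hbdd
  refine ge_of_tendsto hu ?_
  have hinv : Filter.Tendsto (fun k => 1 / u k) Filter.atTop (nhds (1 / sInf A)) :=
    tendsto_const_nhds.div hu hpos.ne'
  have hev : ∀ᶠ k in Filter.atTop, ∀ n ∈ biasedSet v (sInf A),
      min (v n) (1 - v n) < 1 / u k := by
    rw [Filter.eventually_all_finset]
    intro n hn
    exact hinv.eventually (lt_mem_nhds (Finset.mem_filter.1 hn).2)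
  filter_upwards [hev] with k hk
  have hsub : biasedSet v (sInf A) ⊆ biasedSet v (u k) := fun n hn =>
    Finset.mem_filter.2 ⟨Finset.mem_univ n, hk n hn⟩
  have : ((biasedSet v (sInf A)).card : ℝ) ≤ (biasedSet v (u k)).card := by
    exact_mod_cast Finset.card_le_card hsub
  exact this.trans (huA k).2

/-- The interventions on the context and on `N` binary arms; `observe` is the empty
intervention. -/
inductive Intervention (N : ℕ) : Type
  | observe : Intervention N
  | setArm (n : Fin N) (x : Bool) : Intervention N
  | setContext (s : Bool) : Intervention N
  deriving DecidableEq

/-- The interventions available when the context is non-manipulable. -/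
def actionsNMC (N : ℕ) : Finset (Intervention N) :=
  insert .observe (Finset.univ.image fun nx : Fin N × Bool => .setArm nx.1 nx.2)

/-- The interventions available when the context is manipulable. -/
def actionsMC (N : ℕ) : Finset (Intervention N) :=
  actionsNMC N ∪ Finset.univ.image .setContext

/-- The parameters of a Bernoulli hierarchical causal bandit: `α = P(S = 1)`,
`p n = P(X_n = 1 | S = 1)`, `q n = P(X_n = 1 | S = 0)` and `r x = P(Y = 1 | X = x)`. -/
structure Bandit (N : ℕ) where
  α : ℝ
  p : Fin N → ℝ
  q : Fin N → ℝ
  r : (Fin N → Bool) → ℝ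
  α_mem : α ∈ Set.Ioo (0 : ℝ) 1
  p_mem : ∀ n, p n ∈ Set.Ioo (0 : ℝ) 1
  q_mem : ∀ n, q n ∈ Set.Ioo (0 : ℝ) 1
  r_mem : ∀ x, r x ∈ Set.Icc (0 : ℝ) 1

/-- The Bernoulli weight: `P(B = b)` when `P(B = 1) = θ`. -/
def bern (θ : ℝ) (b : Bool) : ℝ := if b then θ else 1 - θ

/-- The law of the context under an intervention. -/
def contextProb {N : ℕ} (M : Bandit N) : Intervention N → Bool → ℝ
  | .setContext s₀, s => if s = s₀ then 1 else 0
  | .observe, s => bern M.α s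
  | .setArm _ _, s => bern M.α s

/-- The law of the value `x` of arm `n` given the context `s`, under an intervention. -/
def armProb {N : ℕ} (M : Bandit N) : Intervention N → Fin N → Bool → Bool → ℝ
  | .setArm n₀ x₀, n, s, x =>
      if n = n₀ then (if x = x₀ then 1 else 0) else bern (if s then M.p n else M.q n) x
  | .observe, n, s, x => bern (if s then M.p n else M.q n) x
  | .setContext _, n, s, x => bern (if s then M.p n else M.q n) x

/-- The joint law `P(S = s, X = x, Y = y | do(a))`, by the factorization along the causal graph. -/
def jointProb {N : ℕ} (M : Bandit N) (a : Intervention N)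
    (s : Bool) (x : Fin N → Bool) (y : Bool) : ℝ :=
  contextProb M a s * (∏ n, armProb M a n s (x n)) * bern (M.r x) y

/-- The expected reward `μ_a = E[Y | do(a)]`. -/
def meanReward {N : ℕ} (M : Bandit N) (a : Intervention N) : ℝ :=
  ∑ s : Bool, ∑ x : Fin N → Bool, ∑ y : Bool, (if y then 1 else 0) * jointProb M a s x y

/-- What is recorded in one round: `(S, X, Y, A)`. -/
abbrev Round {N : ℕ} (𝒜 : Finset (Intervention N)) : Type :=
  Bool × (Fin N → Bool) × Bool × 𝒜

/-- An algorithm with action set `𝒜`. After the history `h` of `t` rounds and with fresh internal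
randomness `w` uniform on `[0,1]`, it outputs the action `act t h w`. With time horizon `T`, the
maps `act t` with `t < T` choose the actions of the `T` rounds and `act T` chooses the action that
is recommended at the end. -/
structure Algorithm {N : ℕ} (𝒜 : Finset (Intervention N)) where
  act : (t : ℕ) → (Fin t → Round 𝒜) → unitInterval → 𝒜
  measurable_act : ∀ t h a, MeasurableSet {w | act t h w = a}

/-- The probability that the output after the history `h` is `a`. -/
def actProb {N : ℕ} {𝒜 : Finset (Intervention N)} (φ : Algorithm 𝒜)
    (t : ℕ) (h : Fin t → Round 𝒜) (a : 𝒜) : ℝ :=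
  (volume : Measure unitInterval).real {w | φ.act t h w = a}

/-- The law of the history of the first `t` rounds when the algorithm `φ` interacts with the
bandit `M`, by the chain rule over the rounds. -/
def historyProb {N : ℕ} {𝒜 : Finset (Intervention N)} (M : Bandit N) (φ : Algorithm 𝒜) :
    (t : ℕ) → (Fin t → Round 𝒜) → ℝ
  | 0, _ => 1
  | t + 1, h =>
      historyProb M φ t (Fin.init h) *
        (match h (Fin.last t) with
          | (s, x, y, a) => actProb φ t (Fin.init h) a * jointProb M a s x y)

/-- The probability that the action recommended after `T` rounds is `a`. -/
def recommendProb {N : ℕ} {𝒜 : Finset (Intervention N)} (M : Bandit N) (φ : Algorithm 𝒜)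
    (T : ℕ) (a : 𝒜) : ℝ :=
  ∑ h : Fin T → Round 𝒜, historyProb M φ T h * actProb φ T h a

/-- The simple regret after `T` rounds. -/
def simpleRegret {N : ℕ} {𝒜 : Finset (Intervention N)} (M : Bandit N) (φ : Algorithm 𝒜)
    (T : ℕ) : ℝ :=
  (⨆ a : 𝒜, meanReward M a) - ∑ a : 𝒜, meanReward M a * recommendProb M φ T a

end HCB

end

noncomputable section

namespace HCB

/-! The context is the only common cause of the arms, so given `S = s` conditioning on `X_n = b` and
intervening by `do(X_n = b)` give `Y` the same law. Hence `E[Y | do(X_n = b)]` is the mixture over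
`s`, with weights `P(S = s)`, of means that can be estimated from observational rounds and from
rounds that play `do(X_n = b)`, pooled (`sum_outcomeProb_cell_mean`). Observation suffices for
values that are not too rare in context `s`; only the rare ones need dedicated rounds, and the
difficulty bounds their number.

The algorithm is a deterministic `rule` with five phases of length `T / 5`: pure observation, the
interventions found rare in context 0, those found rare in context 1, and one phase for each
intervention on the context. It recommends the action with the largest estimate. Where `setContext`
is not available its phases become observational, so one rule serves both action sets.

Concentration comes from exponential supermartingales (`Admissible`) that hold for every algorithm.
Their tuning parameters are deterministic, so Markov's inequality at the final time and one union
bound over `16 N + 12` families suffice, although the sample sizes are random. Outside an event of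
probability at most `(16 N + 12) / (N T)`, the empirical difficulty is at most twice the true one
(`rareLevel_le`), so every pair of arm and value has at least about `P(S = s) T / m` informative
rounds, `m` being the difficulty in context `s` (`sampleSize_le_cnt_informative`). The error in
context `s` is then of order `√(m log(NT) / (P(S = s) T))`; its weight `P(S = s)` turns this into
`√(m P(S = s) log(NT) / T)`, which is the claimed rate. All estimates are within 27 times the rate,
so the regret is at most 2 · 27 + 2 = 56 times the rate. -/

/-- The variables `(S, X, Y)` of one round. -/
abbrev Outcome (N : ℕ) : Type := Bool × (Fin N → Bool) × Bool

/-- The indicator of an event given by a Boolean. -/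
def ind (b : Bool) : ℝ := if b then 1 else 0

@[simp] theorem ind_true : ind true = 1 := rfl

@[simp] theorem ind_false : ind false = 0 := rfl

theorem ind_nonneg (b : Bool) : 0 ≤ ind b := by cases b <;> simp

theorem ind_le_one (b : Bool) : ind b ≤ 1 := by cases b <;> simp

theorem ind_and (b c : Bool) : ind (b && c) = ind b * ind c := by cases b <;> cases c <;> simp

/-! ### Exponential moment bounds for a single round. -/

section ExponentialMoments

/-- A form of Hoeffding's lemma for a Bernoulli variable. -/
theorem bernoulli_exp_le_one {θ : ℝ} (h0 : 0 ≤ θ) (h1 : θ ≤ 1) (l : ℝ) :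
    (1 - θ) * Real.exp (-l * θ - l ^ 2 / 2) + θ * Real.exp (l * (1 - θ) - l ^ 2 / 2) ≤ 1 := by
  set a := Real.exp (l * (1 - θ)) with ha
  set b := Real.exp (-l * θ) with hb
  set a' := Real.exp (-(l * (1 - θ))) with ha'
  set b' := Real.exp (-(-l * θ)) with hb'
  have haa : a * a' = 1 := by rw [ha, ha', ← Real.exp_add]; simp
  have hbb : b * b' = 1 := by rw [hb, hb', ← Real.exp_add]; simp
  have hab : a * b' + b * a' = 2 * Real.cosh l := by
    rw [Real.cosh_eq, ha, hb, ha', hb', ← Real.exp_add, ← Real.exp_add]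
    ring_nf
  -- Symmetrization: multiplying by the moment generating function at `-l`, which is at least 1 by
  -- Jensen, gives that of the difference of two independent copies.
  have hA' : 1 ≤ θ * a' + (1 - θ) * b' := by
    have e1 := mul_le_mul_of_nonneg_left (Real.add_one_le_exp (-(l * (1 - θ)))) h0
    have e2 := mul_le_mul_of_nonneg_left (Real.add_one_le_exp (-(-l * θ))) (sub_nonneg.2 h1)
    rw [← ha'] at e1
    rw [← hb'] at e2
    nlinarith
  have hA : 0 ≤ (1 - θ) * b + θ * a :=
    add_nonneg (mul_nonneg (sub_nonneg.2 h1) (Real.exp_pos _).le)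
      (mul_nonneg h0 (Real.exp_pos _).le)
  have hmul : ((1 - θ) * b + θ * a) * (θ * a' + (1 - θ) * b') =
      1 + 2 * (θ * (1 - θ)) * (Real.cosh l - 1) := by
    linear_combination θ ^ 2 * haa + (1 - θ) ^ 2 * hbb + θ * (1 - θ) * hab
  have hcosh : ((1 - θ) * b + θ * a) ≤ Real.cosh l := by
    calc (1 - θ) * b + θ * a ≤ ((1 - θ) * b + θ * a) * (θ * a' + (1 - θ) * b') :=
          le_mul_of_one_le_right hA hA'
      _ = 1 + 2 * (θ * (1 - θ)) * (Real.cosh l - 1) := hmul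
      _ ≤ Real.cosh l := by
          nlinarith [Real.one_le_cosh l, sq_nonneg (2 * θ - 1)]
  have hs : ∀ u : ℝ, Real.exp (u - l ^ 2 / 2) = Real.exp u * Real.exp (-(l ^ 2 / 2)) := by
    intro u; rw [← Real.exp_add, sub_eq_add_neg]
  rw [hs, hs, ← mul_assoc, ← mul_assoc, ← add_mul]
  calc _ ≤ Real.exp (l ^ 2 / 2) * Real.exp (-(l ^ 2 / 2)) :=
        mul_le_mul_of_nonneg_right (hcosh.trans (Real.cosh_le_exp_half_sq l)) (Real.exp_pos _).le
    _ = 1 := by rw [← Real.exp_add]; simp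

variable {Ω : Type*} [Fintype Ω] {w : Ω → ℝ}

/-- As a function of `Z` in {0,1}, the exponential on `B` is affine, and Hoeffding's lemma says that
its value at `θ` is at most 1. This leaves a multiple of the centred variable, whose mean vanishes;
the probability of `B` plays no role. -/
theorem sum_exp_mean_le_one (hw : ∀ o, 0 ≤ w o) (hw1 : ∑ o, w o = 1) (B Z : Ω → Bool) {θ : ℝ}
    (h0 : 0 ≤ θ) (h1 : θ ≤ 1) (h : ∑ o, w o * (ind (B o) * (ind (Z o) - θ)) = 0) (l : ℝ) :
    ∑ o, w o * Real.exp (ind (B o) * (l * (ind (Z o) - θ) - l ^ 2 / 2)) ≤ 1 := by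
  set c := Real.exp (l * (1 - θ) - l ^ 2 / 2) - Real.exp (-l * θ - l ^ 2 / 2) with hc
  have key := bernoulli_exp_le_one h0 h1 l
  have hpt : ∀ o, Real.exp (ind (B o) * (l * (ind (Z o) - θ) - l ^ 2 / 2)) ≤
      1 + c * (ind (B o) * (ind (Z o) - θ)) := by
    intro o
    cases B o
    · simp
    · cases Z o
      · simp only [ind_true, ind_false, one_mul, zero_sub, hc]
        have : l * -θ = -l * θ := by ring
        rw [this]; nlinarith
      · simp only [ind_true, one_mul, hc]
        nlinarith
  calc _ ≤ ∑ o, w o * (1 + c * (ind (B o) * (ind (Z o) - θ))) :=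
        Finset.sum_le_sum fun o _ => mul_le_mul_of_nonneg_left (hpt o) (hw o)
    _ = ∑ o, w o + c * ∑ o, w o * (ind (B o) * (ind (Z o) - θ)) := by
        rw [Finset.mul_sum, ← Finset.sum_add_distrib]
        exact Finset.sum_congr rfl fun o _ => by ring
    _ = 1 := by rw [h, hw1]; ring

/-- Chernoff's bound: `1 + x ≤ exp x` with `x = (exp l - 1) θ`. -/
theorem sum_exp_count_le_one (hw1 : ∑ o, w o = 1) (Z : Ω → Bool) {θ : ℝ}
    (h : ∑ o, w o * ind (Z o) = θ) (l : ℝ) :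
    ∑ o, w o * Real.exp (l * ind (Z o) - (Real.exp l - 1) * θ) ≤ 1 := by
  have hpt : ∀ o, Real.exp (l * ind (Z o) - (Real.exp l - 1) * θ) =
      (1 + (Real.exp l - 1) * ind (Z o)) * Real.exp (-((Real.exp l - 1) * θ)) := by
    intro o
    rw [sub_eq_add_neg, Real.exp_add]
    cases Z o <;> simp
  calc _ = (∑ o, w o + (Real.exp l - 1) * ∑ o, w o * ind (Z o)) *
        Real.exp (-((Real.exp l - 1) * θ)) := by
        rw [Finset.mul_sum, ← Finset.sum_add_distrib, Finset.sum_mul]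
        exact Finset.sum_congr rfl fun o _ => by rw [hpt]; ring
    _ ≤ Real.exp ((Real.exp l - 1) * θ) * Real.exp (-((Real.exp l - 1) * θ)) := by
        refine mul_le_mul_of_nonneg_right ?_ (Real.exp_pos _).le
        rw [hw1, h]
        linarith [Real.add_one_le_exp ((Real.exp l - 1) * θ)]
    _ = 1 := by rw [← Real.exp_add]; simp

end ExponentialMoments

/-! ### Laws of outcomes and histories; exponential supermartingales. -/

section History

variable {N : ℕ} {𝒜 : Finset (Intervention N)}

/-- The action played in a round. -/
abbrev Round.action (r : Round 𝒜) : 𝒜 := r.2.2.2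

/-- The probability of the outcome `o` under the intervention `a`. -/
def outcomeProb (M : Bandit N) (a : Intervention N) (o : Outcome N) : ℝ :=
  jointProb M a o.1 o.2.1 o.2.2

theorem bern_nonneg {θ : ℝ} (h : θ ∈ Set.Icc (0 : ℝ) 1) (b : Bool) : 0 ≤ bern θ b := by
  cases b <;> simp [bern, h.1, h.2]

theorem bern_pos {θ : ℝ} (h : θ ∈ Set.Ioo (0 : ℝ) 1) (b : Bool) : 0 < bern θ b := by
  cases b <;> simp [bern, h.1, h.2]

theorem sum_bern (θ : ℝ) : ∑ b, bern θ b = 1 := by simp [bern]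

/-- `P(X_n = 1 | S = s)`, as a vector indexed by `n`. -/
def Bandit.armMean (M : Bandit N) (s : Bool) (n : Fin N) : ℝ := if s then M.p n else M.q n

theorem Bandit.armMean_mem (M : Bandit N) (s : Bool) (n : Fin N) :
    M.armMean s n ∈ Set.Ioo (0 : ℝ) 1 := by
  cases s
  · exact M.q_mem n
  · exact M.p_mem n

theorem contextProb_nonneg (M : Bandit N) (a : Intervention N) (s : Bool) :
    0 ≤ contextProb M a s := by
  cases a
  · exact (bern_pos M.α_mem s).le
  · exact (bern_pos M.α_mem s).le
  · simp only [contextProb]; split_ifs <;> norm_num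

theorem sum_contextProb (M : Bandit N) (a : Intervention N) : ∑ s, contextProb M a s = 1 := by
  cases a <;> simp [contextProb, bern]

theorem armProb_nonneg (M : Bandit N) (a : Intervention N) (n : Fin N) (s x : Bool) :
    0 ≤ armProb M a n s x := by
  have h := (bern_pos (M.armMean_mem s n) x).le
  cases a
  · exact h
  · simp only [armProb]; split_ifs
    · norm_num
    · norm_num
    all_goals simpa [Bandit.armMean, *] using h
  · exact h

theorem sum_armProb (M : Bandit N) (a : Intervention N) (n : Fin N) (s : Bool) :
    ∑ x, armProb M a n s x = 1 := by
  cases a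
  · exact sum_bern _
  · simp only [armProb]; split_ifs
    · simp
    all_goals exact sum_bern _
  · exact sum_bern _

theorem outcomeProb_nonneg (M : Bandit N) (a : Intervention N) (o : Outcome N) :
    0 ≤ outcomeProb M a o :=
  mul_nonneg (mul_nonneg (contextProb_nonneg M a _)
    (Finset.prod_nonneg fun n _ => armProb_nonneg M a n _ _)) (bern_nonneg (M.r_mem _) _)

/-- Summation over the outcomes, along the causal order. -/
theorem sum_outcomeProb_mul (M : Bandit N) (a : Intervention N)
    (f : Bool → (Fin N → Bool) → Bool → ℝ) :
    ∑ o : Outcome N, outcomeProb M a o * f o.1 o.2.1 o.2.2 =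
      ∑ s, contextProb M a s * ∑ x : Fin N → Bool, (∏ n, armProb M a n s (x n)) *
        ∑ y, bern (M.r x) y * f s x y := by
  rw [Fintype.sum_prod_type]
  refine Finset.sum_congr rfl fun s _ => ?_
  rw [Fintype.sum_prod_type, Finset.mul_sum]
  refine Finset.sum_congr rfl fun x _ => ?_
  rw [← mul_assoc, Finset.mul_sum]
  exact Finset.sum_congr rfl fun y _ => mul_assoc _ _ _

theorem sum_prod_armProb (M : Bandit N) (a : Intervention N) (s : Bool) :
    ∑ x : Fin N → Bool, ∏ n, armProb M a n s (x n) = 1 := by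
  rw [← Fintype.prod_sum fun n b => armProb M a n s b]
  exact Finset.prod_eq_one fun n _ => sum_armProb M a n s

theorem sum_outcomeProb (M : Bandit N) (a : Intervention N) : ∑ o, outcomeProb M a o = 1 := by
  have h := sum_outcomeProb_mul M a fun _ _ _ => 1
  simpa only [mul_one, sum_bern, sum_prod_armProb, sum_contextProb] using h

theorem meanReward_eq_sum_outcomeProb (M : Bandit N) (a : Intervention N) :
    meanReward M a = ∑ o : Outcome N, outcomeProb M a o * ind o.2.2 := by
  rw [meanReward, Fintype.sum_prod_type]
  refine Finset.sum_congr rfl fun s _ => ?_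
  rw [Fintype.sum_prod_type]
  exact Finset.sum_congr rfl fun x _ => Finset.sum_congr rfl fun y _ => mul_comm _ _

theorem meanReward_nonneg (M : Bandit N) (a : Intervention N) : 0 ≤ meanReward M a := by
  rw [meanReward_eq_sum_outcomeProb]
  exact Finset.sum_nonneg fun o _ => mul_nonneg (outcomeProb_nonneg M a o) (ind_nonneg _)

theorem meanReward_le_one (M : Bandit N) (a : Intervention N) : meanReward M a ≤ 1 := by
  rw [meanReward_eq_sum_outcomeProb, ← sum_outcomeProb M a]
  exact Finset.sum_le_sum fun o _ =>
    mul_le_of_le_one_right (outcomeProb_nonneg M a o) (ind_le_one _)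

theorem actProb_nonneg (φ : Algorithm 𝒜) (t : ℕ) (h : Fin t → Round 𝒜) (a : 𝒜) :
    0 ≤ actProb φ t h a := measureReal_nonneg

theorem sum_actProb (φ : Algorithm 𝒜) (t : ℕ) (h : Fin t → Round 𝒜) :
    ∑ a, actProb φ t h a = 1 := by
  unfold actProb
  rw [← measureReal_biUnion_finset]
  · have : (⋃ a ∈ (Finset.univ : Finset 𝒜), {w | φ.act t h w = a}) = Set.univ := by
      ext w; simp
    rw [this]; simp
  · intro a _ b _ hab
    refine Set.disjoint_left.2 fun w hw hw' => hab ?_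
    rw [← show φ.act t h w = a from hw]
    exact hw'
  · exact fun a _ => φ.measurable_act t h a

theorem historyProb_nonneg (M : Bandit N) (φ : Algorithm 𝒜) (t : ℕ) (h : Fin t → Round 𝒜) :
    0 ≤ historyProb M φ t h := by
  induction t with
  | zero => exact zero_le_one
  | succ t ih =>
    exact mul_nonneg (ih _) (mul_nonneg (actProb_nonneg _ _ _ _)
      (outcomeProb_nonneg M _ ((h (Fin.last t)).1, (h (Fin.last t)).2.1, (h (Fin.last t)).2.2.1)))

/-- The conditional expectation over one round. -/
theorem sum_historyProb_succ (M : Bandit N) (φ : Algorithm 𝒜) (t : ℕ)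
    (G : (Fin (t + 1) → Round 𝒜) → ℝ) :
    ∑ h, historyProb M φ (t + 1) h * G h =
      ∑ h, historyProb M φ t h * ∑ a, actProb φ t h a *
        ∑ o : Outcome N, outcomeProb M a o * G (Fin.snoc (α := fun _ => Round 𝒜) h
          (o.1, o.2.1, o.2.2, a)) := by
  rw [← (Fin.snocEquiv fun _ : Fin (t + 1) => Round 𝒜).sum_comp, Fintype.sum_prod_type_right]
  refine Finset.sum_congr rfl fun h _ => ?_
  have e : ∀ r : Round 𝒜, historyProb M φ (t + 1) (Fin.snoc (α := fun _ => Round 𝒜) h r) =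
      historyProb M φ t h * (actProb φ t h r.2.2.2 *
        outcomeProb M r.2.2.2 (r.1, r.2.1, r.2.2.1)) := by
    intro r
    simp only [historyProb, Fin.init_snoc, Fin.snoc_last, outcomeProb]
  have e' : ∀ r : Round 𝒜, (Fin.snocEquiv fun _ : Fin (t + 1) => Round 𝒜) (r, h) =
      Fin.snoc (α := fun _ => Round 𝒜) h r := fun _ => rfl
  simp only [e', e, Fintype.sum_prod_type]
  simp only [Finset.mul_sum]
  -- The action is stored last in a round but chosen first, so its sum has to move outermost.
  have hc : ∀ (ι : Type) [Fintype ι] (f : ι → 𝒜 → ℝ), ∑ i, ∑ a, f i a = ∑ a, ∑ i, f i a :=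
    fun ι _ f => Finset.sum_comm
  simp_rw [hc]
  refine Finset.sum_congr rfl fun a _ => Finset.sum_congr rfl fun s _ =>
    Finset.sum_congr rfl fun x _ => Finset.sum_congr rfl fun y _ => by ring

theorem sum_historyProb (M : Bandit N) (φ : Algorithm 𝒜) (t : ℕ) :
    ∑ h, historyProb M φ t h = 1 := by
  induction t with
  | zero => simp [historyProb]
  | succ t ih =>
    have h := sum_historyProb_succ M φ t fun _ => 1
    simpa only [mul_one, sum_outcomeProb, sum_actProb, ih] using h

/-- `F` is admissible when the exponential of its sum over the rounds is a supermartingale,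
whatever the algorithm. -/
def Admissible (M : Bandit N) (F : ℕ → Round 𝒜 → ℝ) : Prop :=
  ∀ i (a : 𝒜), ∑ o : Outcome N, outcomeProb M a o * Real.exp (F i (o.1, o.2.1, o.2.2, a)) ≤ 1

/-- The sum of `F` over the rounds of a history. -/
def score (F : ℕ → Round 𝒜 → ℝ) {t : ℕ} (h : Fin t → Round 𝒜) : ℝ :=
  ∑ i : Fin t, F i (h i)

/-- Given the past, the last factor has mean at most 1 under every action, hence under any mixture
of actions the algorithm may choose. -/
theorem sum_historyProb_mul_exp_score_le_one {M : Bandit N} {F : ℕ → Round 𝒜 → ℝ}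
    (hF : Admissible M F) (φ : Algorithm 𝒜) (t : ℕ) :
    ∑ h : Fin t → Round 𝒜, historyProb M φ t h * Real.exp (score F h) ≤ 1 := by
  induction t with
  | zero => simp [historyProb, score]
  | succ t ih =>
    rw [sum_historyProb_succ]
    refine le_trans (Finset.sum_le_sum fun h _ => ?_) ih
    refine mul_le_mul_of_nonneg_left ?_ (historyProb_nonneg _ _ _ _)
    have e : ∀ (a : 𝒜) (o : Outcome N),
        Real.exp (score F (Fin.snoc (α := fun _ => Round 𝒜) h (o.1, o.2.1, o.2.2, a))) =
          Real.exp (F t (o.1, o.2.1, o.2.2, a)) * Real.exp (score F h) := by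
      intro a o
      rw [← Real.exp_add, score, Fin.sum_univ_castSucc, add_comm]
      simp [score]
    simp only [e, ← mul_assoc, ← Finset.sum_mul]
    refine mul_le_of_le_one_left (Real.exp_pos _).le ?_
    rw [← sum_actProb φ t h]
    exact Finset.sum_le_sum fun a _ => mul_le_of_le_one_right (actProb_nonneg _ _ _ _) (hF t a)

/-- Markov's inequality and the union bound for finitely many admissible families. -/
theorem sum_historyProb_bad_le {M : Bandit N} {ι : Type*} [Fintype ι]
    {F : ι → ℕ → Round 𝒜 → ℝ} (hF : ∀ j, Admissible M (F j)) (φ : Algorithm 𝒜) (t : ℕ) (L : ℝ)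
    (E : (Fin t → Round 𝒜) → Prop) [DecidablePred E]
    (hE : ∀ h, E h → ∃ j, L < score (F j) h) :
    ∑ h, (if E h then historyProb M φ t h else 0) ≤ Fintype.card ι * Real.exp (-L) := by
  have hpt : ∀ h, (if E h then historyProb M φ t h else 0) ≤
      ∑ j, historyProb M φ t h * Real.exp (score (F j) h) * Real.exp (-L) := by
    intro h
    have hnn : ∀ j, 0 ≤ historyProb M φ t h * Real.exp (score (F j) h) * Real.exp (-L) :=
      fun j => mul_nonneg (mul_nonneg (historyProb_nonneg _ _ _ _) (Real.exp_pos _).le)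
        (Real.exp_pos _).le
    split_ifs with hh
    · obtain ⟨j, hj⟩ := hE h hh
      refine le_trans ?_ (Finset.single_le_sum (fun j _ => hnn j) (Finset.mem_univ j))
      rw [mul_assoc, ← Real.exp_add]
      exact le_mul_of_one_le_right (historyProb_nonneg _ _ _ _) (Real.one_le_exp (by linarith))
    · exact Finset.sum_nonneg fun j _ => hnn j
  calc _ ≤ ∑ h, ∑ j, historyProb M φ t h * Real.exp (score (F j) h) * Real.exp (-L) :=
        Finset.sum_le_sum fun h _ => hpt h
    _ = ∑ j, (∑ h, historyProb M φ t h * Real.exp (score (F j) h)) * Real.exp (-L) := by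
        rw [Finset.sum_comm]
        exact Finset.sum_congr rfl fun j _ => (Finset.sum_mul _ _ _).symm
    _ ≤ ∑ _j : ι, Real.exp (-L) := Finset.sum_le_sum fun j _ =>
        mul_le_of_le_one_left (Real.exp_pos _).le (sum_historyProb_mul_exp_score_le_one (hF j) φ t)
    _ = _ := by simp

end History

theorem ind_beq_of_ne {a b : Bool} (h : a ≠ b) : ind (a == b) = 0 := by
  rw [beq_false_of_ne h, ind_false]

/-! ### Observation versus intervention on an arm within a context. -/

section Cells

variable {N : ℕ}

/-- `E[Y | S = s, do(X_n = b)]`. -/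
def armValue (M : Bandit N) (s : Bool) (n : Fin N) (b : Bool) : ℝ :=
  ∑ x : Fin N → Bool, (∏ k, armProb M (.setArm n b) k s (x k)) * M.r x

theorem armValue_nonneg (M : Bandit N) (s : Bool) (n : Fin N) (b : Bool) :
    0 ≤ armValue M s n b :=
  Finset.sum_nonneg fun x _ =>
    mul_nonneg (Finset.prod_nonneg fun _ _ => armProb_nonneg _ _ _ _ _) (M.r_mem x).1

theorem armValue_le_one (M : Bandit N) (s : Bool) (n : Fin N) (b : Bool) :
    armValue M s n b ≤ 1 := by
  rw [← sum_prod_armProb M (.setArm n b) s]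
  exact Finset.sum_le_sum fun x _ => mul_le_of_le_one_right
    (Finset.prod_nonneg fun _ _ => armProb_nonneg _ _ _ _ _) (M.r_mem x).2

theorem meanReward_setArm (M : Bandit N) (n : Fin N) (b : Bool) :
    meanReward M (.setArm n b) = ∑ s, bern M.α s * armValue M s n b := by
  rw [meanReward_eq_sum_outcomeProb, sum_outcomeProb_mul M _ fun _ _ y => ind y]
  refine Finset.sum_congr rfl fun s _ => ?_
  simp [contextProb, armValue, bern]

/-- The event `S = s`, `X_n = b`. -/
def cell (s : Bool) (n : Fin N) (b : Bool) (o : Outcome N) : Bool := o.1 == s && o.2.1 n == b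

theorem prod_armProb_setArm_mul_ind (M : Bandit N) (s : Bool) (n : Fin N) (b : Bool)
    (x : Fin N → Bool) :
    (∏ k, armProb M (.setArm n b) k s (x k)) * ind (x n == b) =
      1 * ∏ k, armProb M (.setArm n b) k s (x k) := by
  by_cases h : x n = b
  · simp [h]
  · rw [Finset.prod_eq_zero (Finset.mem_univ n) (by simp [armProb, h])]
    simp

/-- Given the context the arms are independent, so `do(X_n = b)` changes only the factor of arm `n`:
on `X_n = b` the two laws differ by the constant `P(X_n = b | S = s)`. -/
theorem prod_armProb_observe_mul_ind (M : Bandit N) (s : Bool) (n : Fin N) (b : Bool)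
    (x : Fin N → Bool) :
    (∏ k, armProb M .observe k s (x k)) * ind (x n == b) =
      bern (M.armMean s n) b * ∏ k, armProb M (.setArm n b) k s (x k) := by
  by_cases h : x n = b
  · rw [← Finset.mul_prod_erase _ _ (Finset.mem_univ n),
      ← Finset.mul_prod_erase Finset.univ (fun k => armProb M (.setArm n b) k s (x k))
        (Finset.mem_univ n)]
    have : ∏ k ∈ Finset.univ.erase n, armProb M (.setArm n b) k s (x k) =
        ∏ k ∈ Finset.univ.erase n, armProb M .observe k s (x k) :=
      Finset.prod_congr rfl fun k hk => by simp [armProb, Finset.ne_of_mem_erase hk]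
    rw [this]
    simp [armProb, h, Bandit.armMean]
  · rw [Finset.prod_eq_zero (f := fun k => armProb M (.setArm n b) k s (x k))
      (Finset.mem_univ n) (by simp [armProb, h]), ind_beq_of_ne h, mul_zero, mul_zero]

/-- Expectations over a cell, when the action leaves the other arms to chance. -/
theorem sum_outcomeProb_cell (M : Bandit N) (a : Intervention N) (s : Bool) (n : Fin N) (b : Bool)
    (c : ℝ) (hc : ∀ x : Fin N → Bool, (∏ k, armProb M a k s (x k)) * ind (x n == b) =
      c * ∏ k, armProb M (.setArm n b) k s (x k)) (g : Bool → ℝ) :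
    ∑ o, outcomeProb M a o * (ind (cell s n b o) * g o.2.2) =
      contextProb M a s * c * ∑ x : Fin N → Bool, (∏ k, armProb M (.setArm n b) k s (x k)) *
        ∑ y, bern (M.r x) y * g y := by
  have h := sum_outcomeProb_mul M a fun s' x y => ind (s' == s) * (ind (x n == b) * g y)
  have e : ∀ o : Outcome N, ind (cell s n b o) * g o.2.2 =
      ind (o.1 == s) * (ind (o.2.1 n == b) * g o.2.2) := fun o => by
    rw [cell, ind_and, mul_assoc]
  simp only [e]
  rw [h, Finset.sum_eq_single s]
  · rw [mul_assoc, Finset.mul_sum (a := c)]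
    congr 1
    refine Finset.sum_congr rfl fun x _ => ?_
    have hy : ∑ y, bern (M.r x) y * (ind (s == s) * (ind (x n == b) * g y)) =
        ind (x n == b) * ∑ y, bern (M.r x) y * g y := by
      rw [Finset.mul_sum]
      refine Finset.sum_congr rfl fun y _ => ?_
      simp only [beq_self_eq_true, ind_true]
      ring
    rw [hy, ← mul_assoc, hc x, mul_assoc]
  · intro s' _ hs'
    simp only [ind_beq_of_ne hs', zero_mul, mul_zero, Finset.sum_const_zero]
  · simp

/-- This is what allows observational and interventional rounds to be pooled in one average. -/
theorem sum_outcomeProb_cell_mean (M : Bandit N) (a : Intervention N) (s : Bool) (n : Fin N)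
    (b : Bool) (ha : a = .observe ∨ a = .setArm n b) :
    ∑ o, outcomeProb M a o * (ind (cell s n b o) * (ind o.2.2 - armValue M s n b)) = 0 := by
  have h0 : ∑ x : Fin N → Bool, (∏ k, armProb M (.setArm n b) k s (x k)) *
      ∑ y, bern (M.r x) y * (ind y - armValue M s n b) = 0 := by
    have e : ∀ x, ∑ y, bern (M.r x) y * (ind y - armValue M s n b) =
        M.r x - armValue M s n b := fun x => by simp [bern]; ring
    rw [Finset.sum_congr rfl fun x _ => by rw [e x, mul_sub], Finset.sum_sub_distrib,
      ← Finset.sum_mul, sum_prod_armProb, one_mul]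
    exact sub_self _
  rcases ha with rfl | rfl
  · rw [sum_outcomeProb_cell M _ s n b _ (prod_armProb_observe_mul_ind M s n b)
      fun y => ind y - armValue M s n b, h0, mul_zero]
  · rw [sum_outcomeProb_cell M _ s n b _ (prod_armProb_setArm_mul_ind M s n b)
      fun y => ind y - armValue M s n b, h0, mul_zero]

theorem sum_outcomeProb_cell_one (M : Bandit N) (a : Intervention N) (s : Bool) (n : Fin N)
    (b : Bool) (c : ℝ) (hc : ∀ x : Fin N → Bool,
      (∏ k, armProb M a k s (x k)) * ind (x n == b) =
      c * ∏ k, armProb M (.setArm n b) k s (x k)) :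
    ∑ o, outcomeProb M a o * ind (cell s n b o) = contextProb M a s * c := by
  have h := sum_outcomeProb_cell M a s n b c hc fun _ => 1
  simpa only [mul_one, sum_bern, sum_prod_armProb] using h

theorem sum_outcomeProb_context (M : Bandit N) (a : Intervention N) (s : Bool) :
    ∑ o : Outcome N, outcomeProb M a o * ind (o.1 == s) = contextProb M a s := by
  rw [sum_outcomeProb_mul M a fun s' _ _ => ind (s' == s), Finset.sum_eq_single s]
  · simp only [beq_self_eq_true, ind_true, mul_one, sum_bern, sum_prod_armProb]
  · intro s' _ hs'
    simp only [ind_beq_of_ne hs', mul_zero, Finset.sum_const_zero]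
  · simp

end Cells

/-! ### Counts, empirical means and their deviations. -/

section Families

variable {N : ℕ} {𝒜 : Finset (Intervention N)}

/-- The outcome part of a round. -/
abbrev Round.outcome (r : Round 𝒜) : Outcome N := (r.1, r.2.1, r.2.2.1)

/-- The increments that control the deviation of the mean of `Z` over the rounds in `B`. -/
def meanFamily (B Z : ℕ → Round 𝒜 → Bool) (θ l : ℝ) (i : ℕ) (r : Round 𝒜) : ℝ :=
  ind (B i r) * (l * (ind (Z i r) - θ) - l ^ 2 / 2)

/-- The increments that control the number of occurrences of `Z` in the rounds in `B`. -/
def countFamily (B Z : ℕ → Round 𝒜 → Bool) (θ l : ℝ) (i : ℕ) (r : Round 𝒜) : ℝ :=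
  ind (B i r) * (l * ind (Z i r) - (Real.exp l - 1) * θ)

theorem admissible_meanFamily {M : Bandit N} {B Z : ℕ → Round 𝒜 → Bool} {θ : ℝ} (h0 : 0 ≤ θ)
    (h1 : θ ≤ 1) (h : ∀ i (a : 𝒜), ∑ o : Outcome N, outcomeProb M a o *
      (ind (B i (o.1, o.2.1, o.2.2, a)) * (ind (Z i (o.1, o.2.1, o.2.2, a)) - θ)) = 0) (l : ℝ) :
    Admissible M (meanFamily B Z θ l) := fun i a =>
  sum_exp_mean_le_one (outcomeProb_nonneg M a) (sum_outcomeProb M a) _ _ h0 h1 (h i a) l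

/-- The compensator is charged on every round of `B`, so here `B` has to be decided by the action
alone; for `meanFamily` it may depend on the outcome. -/
theorem admissible_countFamily {M : Bandit N} {B Z : ℕ → Round 𝒜 → Bool} {θ : ℝ}
    (C : ℕ → 𝒜 → Bool) (hC : ∀ i r, B i r = C i r.action)
    (h : ∀ i (a : 𝒜), C i a = true → ∑ o : Outcome N, outcomeProb M a o *
      ind (Z i (o.1, o.2.1, o.2.2, a)) = θ) (l : ℝ) :
    Admissible M (countFamily B Z θ l) := by
  intro i a
  cases hb : C i a
  · simp [countFamily, hC, hb, sum_outcomeProb]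
  · simpa [countFamily, hC, hb] using sum_exp_count_le_one (sum_outcomeProb M a) _ (h i a hb) l

/-- The number of rounds in `B`. -/
def cnt (B : ℕ → Round 𝒜 → Bool) {t : ℕ} (h : Fin t → Round 𝒜) : ℝ :=
  ∑ i : Fin t, ind (B i (h i))

theorem cnt_nonneg (B : ℕ → Round 𝒜 → Bool) {t : ℕ} (h : Fin t → Round 𝒜) : 0 ≤ cnt B h :=
  Finset.sum_nonneg fun _ _ => ind_nonneg _

theorem cnt_mono {B B' : ℕ → Round 𝒜 → Bool} (hB : ∀ i r, B i r = true → B' i r = true) {t : ℕ}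
    (h : Fin t → Round 𝒜) : cnt B h ≤ cnt B' h := by
  refine Finset.sum_le_sum fun i _ => ?_
  cases hb : B i (h i)
  · exact ind_nonneg _
  · rw [hB _ _ hb]

/-- The conjunction of two events. -/
def both (B Z : ℕ → Round 𝒜 → Bool) (i : ℕ) (r : Round 𝒜) : Bool := B i r && Z i r

theorem score_meanFamily (B Z : ℕ → Round 𝒜 → Bool) (θ l : ℝ) {t : ℕ} (h : Fin t → Round 𝒜) :
    score (meanFamily B Z θ l) h =
      l * (cnt (both B Z) h - θ * cnt B h) - l ^ 2 / 2 * cnt B h := by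
  simp only [score, meanFamily, cnt, both, ind_and, Finset.mul_sum, ← Finset.sum_sub_distrib]
  exact Finset.sum_congr rfl fun i _ => by ring

theorem score_countFamily (B Z : ℕ → Round 𝒜 → Bool) (θ l : ℝ) {t : ℕ} (h : Fin t → Round 𝒜) :
    score (countFamily B Z θ l) h =
      l * cnt (both B Z) h - (Real.exp l - 1) * θ * cnt B h := by
  simp only [score, countFamily, cnt, both, ind_and, Finset.mul_sum, ← Finset.sum_sub_distrib]
  exact Finset.sum_congr rfl fun i _ => by ring

/-- Multiplicative Chernoff with the fixed parameter -1, since `1 - exp (-1) ≥ 1/2`; the parameter 1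
gives the upper bound below through `exp 1 - 1 ≤ 2`. -/
theorem cnt_lower_of_score_le {B Z : ℕ → Round 𝒜 → Bool} {θ L : ℝ} (hθ : 0 ≤ θ) {t : ℕ}
    {h : Fin t → Round 𝒜} (hs : score (countFamily B Z θ (-1)) h ≤ L) :
    1 / 2 * (θ * cnt B h) - L ≤ cnt (both B Z) h := by
  rw [score_countFamily] at hs
  have he : Real.exp (-1) ≤ 1 / 2 := by
    rw [Real.exp_neg, inv_le_comm₀ (Real.exp_pos _) (by norm_num)]
    linarith [Real.add_one_le_exp (1 : ℝ)]
  nlinarith [mul_nonneg hθ (cnt_nonneg B h)]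

theorem cnt_upper_of_score_le {B Z : ℕ → Round 𝒜 → Bool} {θ L : ℝ} (hθ : 0 ≤ θ) {t : ℕ}
    {h : Fin t → Round 𝒜} (hs : score (countFamily B Z θ 1) h ≤ L) :
    cnt (both B Z) h ≤ 2 * (θ * cnt B h) + L := by
  rw [score_countFamily] at hs
  nlinarith [mul_nonneg hθ (cnt_nonneg B h), Real.exp_one_lt_d9]

/-- The empirical mean of `Z` over the rounds in `B`. -/
def avg (B Z : ℕ → Round 𝒜 → Bool) {t : ℕ} (h : Fin t → Round 𝒜) : ℝ :=
  cnt (both B Z) h / cnt B h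

theorem avg_nonneg (B Z : ℕ → Round 𝒜 → Bool) {t : ℕ} (h : Fin t → Round 𝒜) : 0 ≤ avg B Z h :=
  div_nonneg (cnt_nonneg _ _) (cnt_nonneg _ _)

theorem avg_le_one (B Z : ℕ → Round 𝒜 → Bool) {t : ℕ} (h : Fin t → Round 𝒜) : avg B Z h ≤ 1 :=
  div_le_one_of_le₀ (cnt_mono (fun i r hb => by
    simp only [both, Bool.and_eq_true] at hb; exact hb.1) h) (cnt_nonneg _ _)

/-- The sign `1` or `-1`. -/
def sgn (b : Bool) : ℝ := if b then 1 else -1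

/-- With `l = √(2L/k)` and `K` the random count, a score of at most `L` bounds the deviation by `l/2
+ L/(lK)`, and the second term is at most `l/2` once `K ≥ k`. As `l` depends only on the
deterministic `k`, no union over sample sizes is needed. -/
theorem abs_avg_sub_le {B Z : ℕ → Round 𝒜 → Bool} {θ L k : ℝ} (hL : 0 < L) (hk : 0 < k) {t : ℕ}
    {h : Fin t → Round 𝒜} (hB : k ≤ cnt B h)
    (hs : ∀ σ, score (meanFamily B Z θ (sgn σ * Real.sqrt (2 * L / k))) h ≤ L) :
    |avg B Z h - θ| ≤ Real.sqrt (2 * L / k) := by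
  set l := Real.sqrt (2 * L / k) with hl
  have hlpos : 0 < l := Real.sqrt_pos.2 (by positivity)
  have hsq : l ^ 2 = 2 * L / k := Real.sq_sqrt (by positivity)
  have hK : 0 < cnt B h := hk.trans_le hB
  have hLK : L ≤ l ^ 2 / 2 * cnt B h := by
    have e : L = l ^ 2 / 2 * k := by rw [hsq]; field_simp
    calc L = l ^ 2 / 2 * k := e
      _ ≤ _ := mul_le_mul_of_nonneg_left hB (by positivity)
  have h1 := hs true
  have h2 := hs false
  simp only [score_meanFamily, sgn, if_true, Bool.false_eq_true, if_false, one_mul] at h1 h2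
  have hup : cnt (both B Z) h - θ * cnt B h ≤ l * cnt B h := by
    refine le_of_mul_le_mul_left ?_ hlpos
    nlinarith
  have hlo : -(cnt (both B Z) h - θ * cnt B h) ≤ l * cnt B h := by
    refine le_of_mul_le_mul_left ?_ hlpos
    nlinarith
  have e : avg B Z h - θ = (cnt (both B Z) h - θ * cnt B h) / cnt B h := by
    rw [avg]; field_simp
  rw [e, abs_div, abs_of_pos hK, div_le_iff₀ hK]
  exact abs_le.2 ⟨by linarith, hup⟩

theorem le_cnt_of_forall {B : ℕ → Round 𝒜 → Bool} {t : ℕ} {h : Fin t → Round 𝒜} (a w : ℕ)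
    (hw : a + w ≤ t) (hB : ∀ i : Fin t, a ≤ i → (i : ℕ) < a + w → B i (h i) = true) :
    (w : ℝ) ≤ cnt B h := by
  have hinj : Function.Injective fun j : Fin w => (⟨a + j, by omega⟩ : Fin t) := by
    intro i j hij
    simp only [Fin.mk.injEq] at hij
    exact Fin.ext (by omega)
  calc (w : ℝ) = ∑ _j : Fin w, (1 : ℝ) := by simp
    _ = ∑ i ∈ Finset.univ.map ⟨_, hinj⟩, ind (B i (h i)) := by
        rw [Finset.sum_map]
        refine Finset.sum_congr rfl fun j _ => ?_
        have := hB ⟨a + j, by omega⟩ (by simp) (by simp)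
        simp only [Function.Embedding.coeFn_mk, this, ind_true]
    _ ≤ _ := Finset.sum_le_sum_of_subset_of_nonneg (Finset.subset_univ _)
        fun _ _ _ => ind_nonneg _

theorem cnt_castLE {B : ℕ → Round 𝒜 → Bool} {m s t : ℕ} (hB : ∀ i r, B i r = true → i < m)
    (hm : m ≤ s) (hst : s ≤ t) (h : Fin t → Round 𝒜) :
    cnt B (fun j : Fin s => h (Fin.castLE hst j)) = cnt B h := by
  refine Fintype.sum_of_injective (Fin.castLE hst) (Fin.castLE_injective hst) _ _ ?_
    fun i => by simp
  intro i hi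
  have hs : ¬ (i : ℕ) < m := fun hlt => hi ⟨⟨i, by omega⟩, by simp⟩
  cases hb : B i (h i)
  · simp
  · exact absurd (hB _ _ hb) hs

end Families

theorem observe_mem_actionsNMC (N : ℕ) : Intervention.observe ∈ actionsNMC N :=
  Finset.mem_insert_self _ _

theorem setArm_mem_actionsNMC {N : ℕ} (n : Fin N) (b : Bool) :
    Intervention.setArm n b ∈ actionsNMC N :=
  Finset.mem_insert_of_mem (Finset.mem_image.2 ⟨(n, b), Finset.mem_univ _, rfl⟩)

/-! ### Deterministic rules and their simple regret. -/

section Deterministic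

variable {N : ℕ} {𝒜 : Finset (Intervention N)}

/-- The algorithm that follows a deterministic rule. -/
def Algorithm.ofRule (d : (t : ℕ) → (Fin t → Round 𝒜) → 𝒜) : Algorithm 𝒜 where
  act t h _ := d t h
  measurable_act _ _ _ := MeasurableSet.const _

theorem actProb_ofRule (d : (t : ℕ) → (Fin t → Round 𝒜) → 𝒜) (t : ℕ) (h : Fin t → Round 𝒜)
    (a : 𝒜) : actProb (Algorithm.ofRule d) t h a = if d t h = a then 1 else 0 := by
  by_cases hd : d t h = a <;> simp [actProb, Algorithm.ofRule, hd]

/-- A history of positive probability follows the rule. -/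
theorem action_eq_of_historyProb_ne_zero {M : Bandit N}
    {d : (t : ℕ) → (Fin t → Round 𝒜) → 𝒜} {t : ℕ} {h : Fin t → Round 𝒜}
    (hh : historyProb M (Algorithm.ofRule d) t h ≠ 0) (i : Fin t) :
    (h i).action = d i fun j => h (Fin.castLE i.is_lt.le j) := by
  induction t with
  | zero => exact i.elim0
  | succ t ih =>
    simp only [historyProb, actProb_ofRule] at hh
    obtain ⟨h1, h2⟩ := mul_ne_zero_iff.1 hh
    refine Fin.lastCases ?_ (fun i => ?_) i
    · by_contra hne
      exact h2 (by rw [if_neg fun e => hne e.symm, zero_mul])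
    · exact ih h1 i

theorem recommendProb_ofRule (M : Bandit N) (d : (t : ℕ) → (Fin t → Round 𝒜) → 𝒜) (T : ℕ)
    (f : 𝒜 → ℝ) :
    ∑ a, f a * recommendProb M (Algorithm.ofRule d) T a =
      ∑ h, historyProb M (Algorithm.ofRule d) T h * f (d T h) := by
  simp only [recommendProb, actProb_ofRule, Finset.mul_sum]
  rw [Finset.sum_comm]
  refine Finset.sum_congr rfl fun h _ => ?_
  rw [Finset.sum_eq_single (d T h)]
  · simp [mul_comm]
  · intro a _ ha
    simp [ha.symm]
  · simp

/-- The simple regret of a rule whose recommendation is good outside an event `E`. -/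
theorem simpleRegret_ofRule_le (M : Bandit N) (d : (t : ℕ) → (Fin t → Round 𝒜) → 𝒜) (T : ℕ)
    (E : (Fin T → Round 𝒜) → Prop) [DecidablePred E] (ε δ : ℝ) (hε : 0 ≤ ε)
    (hE : ∑ h, (if E h then historyProb M (Algorithm.ofRule d) T h else 0) ≤ δ)
    (hgood : ∀ h, historyProb M (Algorithm.ofRule d) T h ≠ 0 → ¬ E h →
      ∀ a : 𝒜, meanReward M a ≤ meanReward M (d T h) + ε) :
    simpleRegret M (Algorithm.ofRule d) T ≤ ε + δ := by
  -- Without actions the supremum takes the default value 0, so only the sign of `δ` matters.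
  rcases isEmpty_or_nonempty 𝒜 with hemp | hne
  · have hδ : 0 ≤ δ := le_trans (Finset.sum_nonneg fun h _ => by
      split_ifs
      · exact historyProb_nonneg _ _ _ _
      · exact le_rfl) hE
    simp only [simpleRegret, Real.iSup_of_isEmpty, Finset.univ_eq_empty, Finset.sum_empty]
    linarith
  set P := historyProb M (Algorithm.ofRule d) T with hP
  have h1 : ∑ h, P h = 1 := sum_historyProb _ _ _
  have hpt : ∀ h, P h * ((⨆ a : 𝒜, meanReward M a) - meanReward M (d T h)) ≤
      P h * ε + if E h then P h else 0 := by
    intro h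
    have hnn : 0 ≤ P h := historyProb_nonneg _ _ _ _
    by_cases h0 : P h = 0
    · simp [h0]
    split_ifs with hEh
    -- On `E` the loss is bounded trivially by 1.
    · have : (⨆ a : 𝒜, meanReward M a) ≤ 1 := ciSup_le fun a => meanReward_le_one M a
      nlinarith [meanReward_nonneg M (d T h), mul_nonneg hnn hε,
        mul_nonneg hnn (meanReward_nonneg M (d T h))]
    · rw [add_zero]
      refine mul_le_mul_of_nonneg_left ?_ hnn
      have : (⨆ a : 𝒜, meanReward M a) ≤ meanReward M (d T h) + ε := ciSup_le (hgood h h0 hEh)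
      linarith
  calc simpleRegret M (Algorithm.ofRule d) T
      = ∑ h, P h * ((⨆ a : 𝒜, meanReward M a) - meanReward M (d T h)) := by
        rw [simpleRegret, recommendProb_ofRule M d T fun a => meanReward M a]
        simp only [mul_sub, Finset.sum_sub_distrib, ← Finset.sum_mul, h1, one_mul, ← hP]
    _ ≤ ∑ h, (P h * ε + if E h then P h else 0) := Finset.sum_le_sum fun h _ => hpt h
    _ = ε + ∑ h, (if E h then P h else 0) := by
        rw [Finset.sum_add_distrib, ← Finset.sum_mul, h1, one_mul]
    _ ≤ ε + δ := by linarith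

end Deterministic

/-! ### The algorithm and the sample counts its schedule guarantees. -/

section Rule

variable {N : ℕ} {𝒜 : Finset (Intervention N)}

/-- The observational rounds among the first `m`. -/
def observed (m i : ℕ) (r : Round 𝒜) : Bool :=
  decide (i < m) && decide (r.action.1 = Intervention.observe)

/-- The rounds in which the context is `s`. -/
def inContext (s : Bool) (_ : ℕ) (r : Round 𝒜) : Bool := r.1 == s

/-- The rounds in which the context is `s` and arm `n` has the value `b`. -/
def inCell (s : Bool) (n : Fin N) (b : Bool) (_ : ℕ) (r : Round 𝒜) : Bool := cell s n b r.outcome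

/-- The rounds in which the action is `a`. -/
def playing (a : Intervention N) (_ : ℕ) (r : Round 𝒜) : Bool := decide (r.action.1 = a)

/-- The rounds that are informative on the effect of `X_n = b` in context `s`. -/
def informative (s : Bool) (n : Fin N) (b : Bool) (i : ℕ) (r : Round 𝒜) : Bool :=
  inCell s n b i r && (decide (r.action.1 = .observe) || decide (r.action.1 = .setArm n b))

/-- The rounds with reward `1`. -/
def rewarded (_ : ℕ) (r : Round 𝒜) : Bool := r.2.2.1

/-- The arms with a value that is observed in less than a fraction `1 / (5 k)` of the first `m`
rounds in context `s`. -/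
def rareSet (m : ℕ) (s : Bool) {t : ℕ} (h : Fin t → Round 𝒜) (k : ℕ) : Finset (Fin N) :=
  Finset.univ.filter fun n => ∃ b,
    5 * (k : ℝ) * cnt (both (observed m) (inCell s n b)) h <
      cnt (both (observed m) (inContext s)) h

theorem exists_card_rareSet_le (m : ℕ) (s : Bool) {t : ℕ} (h : Fin t → Round 𝒜) :
    ∃ k, (rareSet m s h k).card ≤ k :=
  ⟨N, (Finset.card_le_univ _).trans (Fintype.card_fin N).le⟩

/-- The estimated difficulty in context `s`. -/
def rareLevel (m : ℕ) (s : Bool) {t : ℕ} (h : Fin t → Round 𝒜) : ℕ :=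
  Nat.find (exists_card_rareSet_le m s h)

/-- The interventions that are tried because of context `s`. -/
def rarePairs (m : ℕ) (s : Bool) {t : ℕ} (h : Fin t → Round 𝒜) : Finset (Fin N × Bool) :=
  rareSet m s h (rareLevel m s h) ×ˢ Finset.univ

/-- The action in round `j` of a phase of length `m` which is divided evenly among the
interventions in `P`. -/
def blockAction (P : Finset (Fin N × Bool)) (m j : ℕ) : Intervention N :=
  if hj : j / (m / P.card) < P.card then
    .setArm (P.equivFin.symm ⟨_, hj⟩).1.1 (P.equivFin.symm ⟨_, hj⟩).1.2
  else .observe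

/-- The schedule, in phases of length `m`. -/
def schedule (m t : ℕ) (h : Fin t → Round 𝒜) : Intervention N :=
  if t < m then .observe
  else if t < 2 * m then blockAction (rarePairs m false h) m (t - m)
  else if t < 3 * m then blockAction (rarePairs m true h) m (t - 2 * m)
  else if t < 4 * m then .setContext false
  else if t < 5 * m then .setContext true
  else .observe

/-- The estimate of the expected reward of `a` from the rounds in which `a` is played. -/
def directEstimate (a : Intervention N) {t : ℕ} (h : Fin t → Round 𝒜) : ℝ :=
  avg (playing a) rewarded h

/-- The estimate of the expected reward of `a`. -/
def estimate (m : ℕ) (a : Intervention N) {t : ℕ} (h : Fin t → Round 𝒜) : ℝ :=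
  match a with
  | .setArm n b =>
      avg (observed m) (inContext true) h * avg (informative true n b) rewarded h +
        (1 - avg (observed m) (inContext true) h) * avg (informative false n b) rewarded h
  | .observe => directEstimate .observe h
  | .setContext s => directEstimate (.setContext s) h

theorem exists_max_estimate (h𝒜 : actionsNMC N ⊆ 𝒜) (m : ℕ) {t : ℕ} (h : Fin t → Round 𝒜) :
    ∃ a : 𝒜, ∀ a' : 𝒜, estimate m a' h ≤ estimate m a h :=
  haveI : Nonempty 𝒜 := ⟨⟨_, h𝒜 (observe_mem_actionsNMC N)⟩⟩
  Finite.exists_max fun a : 𝒜 => estimate m a h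

/-- The intervention `a` if it is available, and the empty intervention otherwise. -/
def available (h𝒜 : actionsNMC N ⊆ 𝒜) (a : Intervention N) : 𝒜 :=
  if ha : a ∈ 𝒜 then ⟨a, ha⟩ else ⟨_, h𝒜 (observe_mem_actionsNMC N)⟩

theorem available_coe (h𝒜 : actionsNMC N ⊆ 𝒜) {a : Intervention N} (ha : a ∈ 𝒜) :
    (available h𝒜 a : Intervention N) = a := by
  rw [available, dif_pos ha]

/-- The rule with horizon `T`: five phases of length `T / 5`, then the action with the largest
estimate. -/
def rule (h𝒜 : actionsNMC N ⊆ 𝒜) (T t : ℕ) (h : Fin t → Round 𝒜) : 𝒜 :=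
  if t < T then available h𝒜 (schedule (T / 5) t h)
  else (exists_max_estimate h𝒜 (T / 5) h).choose

theorem estimate_le_estimate_rule (h𝒜 : actionsNMC N ⊆ 𝒜) (T : ℕ) (h : Fin T → Round 𝒜) (a : 𝒜) :
    estimate (T / 5) a h ≤ estimate (T / 5) (rule h𝒜 T T h) h := by
  rw [rule, if_neg (lt_irrefl T)]
  exact (exists_max_estimate h𝒜 (T / 5) h).choose_spec a

theorem blockAction_eq {P : Finset (Fin N × Bool)} {p : Fin N × Bool} (hp : p ∈ P) {m j : ℕ}
    (h1 : P.equivFin ⟨p, hp⟩ * (m / P.card) ≤ j)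
    (h2 : j < P.equivFin ⟨p, hp⟩ * (m / P.card) + m / P.card) :
    blockAction P m j = .setArm p.1 p.2 := by
  -- A block of length zero would leave no `j` satisfying `h1` and `h2`.
  have hw : 0 < m / P.card := by omega
  have hj : j / (m / P.card) = P.equivFin ⟨p, hp⟩ := by
    rw [Nat.div_eq_iff hw]
    constructor
    · exact h1
    · omega
  have hlt : j / (m / P.card) < P.card := hj ▸ (P.equivFin ⟨p, hp⟩).is_lt
  have e : P.equivFin.symm ⟨_, hlt⟩ = ⟨p, hp⟩ := by
    rw [Equiv.symm_apply_eq]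
    exact Fin.ext hj
  rw [blockAction, dif_pos hlt, e]

theorem block_add_le {P : Finset (Fin N × Bool)} (m : ℕ) (j : Fin P.card) :
    j * (m / P.card) + m / P.card ≤ m := by
  calc (j : ℕ) * (m / P.card) + m / P.card = (j + 1) * (m / P.card) := by ring
    _ ≤ P.card * (m / P.card) := Nat.mul_le_mul_right _ j.is_lt
    _ ≤ m := Nat.mul_div_le m _

/-- The schedule recomputes the rare interventions from the current history. They depend only on the
first `m` rounds, so they stay fixed after the first phase and agree with those of the full history.
-/
theorem rarePairs_castLE (m : ℕ) (s : Bool) {t T : ℕ} (hm : m ≤ t) (ht : t ≤ T)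
    (h : Fin T → Round 𝒜) :
    rarePairs m s (fun j : Fin t => h (Fin.castLE ht j)) = rarePairs m s h := by
  have hc : ∀ Z : ℕ → Round 𝒜 → Bool, cnt (both (observed m) Z)
      (fun j : Fin t => h (Fin.castLE ht j)) = cnt (both (observed m) Z) h := fun Z =>
    cnt_castLE (m := m) (fun i r hb => by simp [both, observed] at hb; exact hb.1.1) hm ht h
  have hr : rareSet m s (fun j : Fin t => h (Fin.castLE ht j)) = rareSet m s h := by
    funext k
    simp only [rareSet, hc]
  have hl : rareLevel m s (fun j : Fin t => h (Fin.castLE ht j)) = rareLevel m s h := by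
    simp only [rareLevel, hr]
  rw [rarePairs, rarePairs, hr, hl]

variable {h𝒜 : actionsNMC N ⊆ 𝒜} {T : ℕ} {M : Bandit N} {h : Fin T → Round 𝒜}

theorem action_eq_schedule
    (hh : historyProb M (Algorithm.ofRule (rule h𝒜 T)) T h ≠ 0) (i : Fin T)
    {a : Intervention N} (ha : a ∈ 𝒜)
    (hs : schedule (T / 5) i (fun j => h (Fin.castLE i.is_lt.le j)) = a) :
    (h i).action.1 = a := by
  rw [action_eq_of_historyProb_ne_zero hh i, rule, if_pos i.is_lt, hs, available_coe _ ha]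

theorem le_cnt_observed (hh : historyProb M (Algorithm.ofRule (rule h𝒜 T)) T h ≠ 0) :
    ((T / 5 : ℕ) : ℝ) ≤ cnt (observed (T / 5)) h := by
  refine le_cnt_of_forall 0 (T / 5) (by omega) fun i _ hi => ?_
  have := action_eq_schedule hh i (h𝒜 (observe_mem_actionsNMC N))
    (by rw [schedule, if_pos (by omega)])
  simp only [observed, this, Bool.and_eq_true, decide_eq_true_eq, and_true]
  omega

theorem le_cnt_playing_observe (hh : historyProb M (Algorithm.ofRule (rule h𝒜 T)) T h ≠ 0) :
    ((T / 5 : ℕ) : ℝ) ≤ cnt (playing .observe) h :=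
  (le_cnt_observed hh).trans (cnt_mono (fun i r hb => by
    simp only [observed, Bool.and_eq_true] at hb; exact hb.2) h)

theorem le_cnt_playing_setContext (hh : historyProb M (Algorithm.ofRule (rule h𝒜 T)) T h ≠ 0)
    {s : Bool} (hs : .setContext s ∈ 𝒜) :
    ((T / 5 : ℕ) : ℝ) ≤ cnt (playing (.setContext s)) h := by
  cases s
  · refine le_cnt_of_forall (3 * (T / 5)) (T / 5) (by omega) fun i hi hi' => ?_
    have := action_eq_schedule hh i hs (by
      rw [schedule, if_neg (by omega), if_neg (by omega), if_neg (by omega), if_pos (by omega)])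
    simp [playing, this]
  · refine le_cnt_of_forall (4 * (T / 5)) (T / 5) (by omega) fun i hi hi' => ?_
    have := action_eq_schedule hh i hs (by
      rw [schedule, if_neg (by omega), if_neg (by omega), if_neg (by omega), if_neg (by omega),
        if_pos (by omega)])
    simp [playing, this]

theorem le_cnt_playing_setArm (hh : historyProb M (Algorithm.ofRule (rule h𝒜 T)) T h ≠ 0)
    {s : Bool} {n : Fin N} {b : Bool} (hp : (n, b) ∈ rarePairs (T / 5) s h) :
    ((T / 5 / (rarePairs (T / 5) s h).card : ℕ) : ℝ) ≤ cnt (playing (.setArm n b)) h := by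
  set m := T / 5 with hm
  set j := (rarePairs m s h).equivFin ⟨_, hp⟩ with hj
  have hle := block_add_le m j
  have ha : Intervention.setArm n b ∈ 𝒜 := h𝒜 (setArm_mem_actionsNMC n b)
  cases s
  · refine le_cnt_of_forall (m + j * (m / (rarePairs m false h).card)) _ (by omega)
      fun i hi hi' => ?_
    have := action_eq_schedule hh i ha (by
      rw [schedule, if_neg (by omega), if_pos (by omega), ← hm,
        rarePairs_castLE m false (by omega)]
      exact blockAction_eq hp (by rw [← hj]; omega) (by rw [← hj]; omega))
    simp [playing, this]
  · refine le_cnt_of_forall (2 * m + j * (m / (rarePairs m true h).card)) _ (by omega)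
      fun i hi hi' => ?_
    have := action_eq_schedule hh i ha (by
      rw [schedule, if_neg (by omega), if_neg (by omega), if_pos (by omega), ← hm,
        rarePairs_castLE m true (by omega)]
      exact blockAction_eq hp (by rw [← hj]; omega) (by rw [← hj]; omega))
    simp [playing, this]

end Rule

/-! ### Elementary bounds for the difficulty. -/

section Difficulty

variable {N : ℕ}

/-- For `s < 1` every arm counts as biased, so `s` would have to be at least `N ≥ 1`. -/
theorem one_le_difficulty (hN : 1 ≤ N) (v : Fin N → ℝ) : 1 ≤ difficulty v := by
  obtain ⟨hpos, hcard⟩ := (isLeast_difficulty hN v).1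
  by_contra! hlt
  have hinv : 1 < 1 / difficulty v := by rw [lt_div_iff₀ hpos]; linarith
  have huniv : biasedSet v (difficulty v) = Finset.univ := by
    ext n
    simp only [biasedSet, Finset.mem_filter, Finset.mem_univ, true_and, iff_true]
    rcases min_choice (v n) (1 - v n) with h | h <;>
      linarith [min_le_left (v n) (1 - v n), min_le_right (v n) (1 - v n)]
  rw [huniv, Finset.card_univ, Fintype.card_fin] at hcard
  have : (1 : ℝ) ≤ N := by exact_mod_cast hN
  linarith

theorem card_biasedSet_difficulty_le (hN : 1 ≤ N) (v : Fin N → ℝ) :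
    ((biasedSet v (difficulty v)).card : ℝ) ≤ difficulty v :=
  (isLeast_difficulty hN v).1.2

theorem one_div_le_bern {v : Fin N → ℝ} {s : ℝ} {n : Fin N} (hn : n ∉ biasedSet v s) (b : Bool) :
    1 / s ≤ bern (v n) b := by
  simp only [biasedSet, Finset.mem_filter, Finset.mem_univ, true_and, not_lt, le_min_iff] at hn
  cases b
  · simpa [bern] using hn.2
  · simpa [bern] using hn.1

end Difficulty

/-! ### The families of deviations and their admissibility. -/

section Events

variable {N : ℕ} {𝒜 : Finset (Intervention N)}

/-- The difficulty in context `s`. -/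
def Bandit.diff (M : Bandit N) (s : Bool) : ℝ := difficulty (M.armMean s)

/-- A lower bound for the number of informative rounds in context `s`. -/
def sampleSize (M : Bandit N) (T : ℕ) (s : Bool) : ℝ := bern M.α s * T / (126 * M.diff s)

/-- The interventions other than those on an arm. -/
def direct (N : ℕ) (c : Option Bool) : Intervention N := c.elim .observe .setContext

/-- Indices of the families that control the estimates. -/
abbrev EventIndex (N : ℕ) : Type :=
  ((Bool × Fin N × Bool) × Bool) ⊕ (Bool × Fin N × Bool) ⊕ (Bool × Fin N × Bool) ⊕
    (Bool × Bool) ⊕ Bool ⊕ (Option Bool × Bool)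

/-- The families that control the estimates. -/
def family (𝒜 : Finset (Intervention N)) (M : Bandit N) (T : ℕ) (L : ℝ) :
    EventIndex N → ℕ → Round 𝒜 → ℝ :=
  Sum.elim (fun p => meanFamily (informative p.1.1 p.1.2.1 p.1.2.2) rewarded
    (armValue M p.1.1 p.1.2.1 p.1.2.2) (sgn p.2 * Real.sqrt (2 * L / sampleSize M T p.1.1))) <|
  Sum.elim (fun p => countFamily (observed (T / 5)) (inCell p.1 p.2.1 p.2.2)
    (bern M.α p.1 * bern (M.armMean p.1 p.2.1) p.2.2) (-1)) <|
  Sum.elim (fun p => countFamily (playing (.setArm p.2.1 p.2.2)) (inCell p.1 p.2.1 p.2.2)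
    (bern M.α p.1) (-1)) <|
  Sum.elim (fun p => countFamily (observed (T / 5)) (inContext p.1) (bern M.α p.1) (sgn p.2)) <|
  Sum.elim (fun σ => meanFamily (observed (T / 5)) (inContext true) M.α
    (sgn σ * Real.sqrt (2 * L / (T / 5 : ℕ))))
  (fun p => meanFamily (playing (direct N p.1)) rewarded (meanReward M (direct N p.1))
    (sgn p.2 * Real.sqrt (2 * L / (T / 5 : ℕ))))

theorem card_eventIndex (N : ℕ) : Fintype.card (EventIndex N) = 16 * N + 12 := by
  simp only [EventIndex, Fintype.card_sum, Fintype.card_prod, Fintype.card_bool, Fintype.card_fin,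
    Fintype.card_option]
  ring

theorem sum_outcomeProb_mul_sub (M : Bandit N) (a : Intervention N) (f : Outcome N → ℝ) (θ : ℝ)
    (hf : ∑ o, outcomeProb M a o * f o = θ) : ∑ o, outcomeProb M a o * (f o - θ) = 0 := by
  simp only [mul_sub, Finset.sum_sub_distrib, ← Finset.sum_mul, sum_outcomeProb, hf]
  ring

theorem admissible_family (M : Bandit N) (T : ℕ) (L : ℝ) (j : EventIndex N) :
    Admissible M (family 𝒜 M T L j) := by
  rcases j with ⟨⟨s, n, b⟩, σ⟩ | ⟨s, n, b⟩ | ⟨s, n, b⟩ | ⟨s, σ⟩ | σ | ⟨c, σ⟩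
  · refine admissible_meanFamily (armValue_nonneg _ _ _ _) (armValue_le_one _ _ _ _)
      (fun i a => ?_) _
    by_cases ha : a.1 = .observe ∨ a.1 = .setArm n b
    · have e : ∀ o : Outcome N, informative (𝒜 := 𝒜) s n b i (o.1, o.2.1, o.2.2, a) =
          cell s n b o := by
        intro o
        have : (decide (a.1 = .observe) || decide (a.1 = .setArm n b)) = true := by
          simpa using ha
        simp only [informative, this, Bool.and_true, inCell]
      simp only [e]
      exact sum_outcomeProb_cell_mean M a.1 s n b ha
    · refine Finset.sum_eq_zero fun o _ => ?_
      have : (decide (a.1 = .observe) || decide (a.1 = .setArm n b)) = false := by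
        simpa using ha
      simp [informative, this]
  · refine admissible_countFamily (fun i a => decide (i < T / 5) && decide (a.1 = .observe))
      (fun i r => rfl) (fun i a ha => ?_) _
    simp only [Bool.and_eq_true, decide_eq_true_eq] at ha
    have h := sum_outcomeProb_cell_one M .observe s n b _ (prod_armProb_observe_mul_ind M s n b)
    rw [ha.2]
    exact h
  · refine admissible_countFamily (fun i a => decide (a.1 = .setArm n b))
      (fun i r => rfl) (fun i a ha => ?_) _
    simp only [decide_eq_true_eq] at ha
    have h := sum_outcomeProb_cell_one M (.setArm n b) s n b _
      (prod_armProb_setArm_mul_ind M s n b)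
    rw [mul_one] at h
    rw [ha]
    exact h
  · refine admissible_countFamily (fun i a => decide (i < T / 5) && decide (a.1 = .observe))
      (fun i r => rfl) (fun i a ha => ?_) _
    simp only [Bool.and_eq_true, decide_eq_true_eq] at ha
    rw [ha.2]
    exact sum_outcomeProb_context M .observe s
  · refine admissible_meanFamily M.α_mem.1.le M.α_mem.2.le (fun i a => ?_) _
    by_cases ha : i < T / 5 ∧ a.1 = .observe
    · have : (decide (i < T / 5) && decide (a.1 = .observe)) = true := by simpa using ha
      simp only [observed, this, ind_true, one_mul]
      rw [ha.2]
      exact sum_outcomeProb_mul_sub M .observe _ _ (sum_outcomeProb_context M .observe true)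
    · refine Finset.sum_eq_zero fun o _ => ?_
      have : (decide (i < T / 5) && decide (a.1 = .observe)) = false := by
        rw [← Bool.decide_and, decide_eq_false ha]
      simp [observed, this]
  · refine admissible_meanFamily (meanReward_nonneg _ _) (meanReward_le_one _ _)
      (fun i a => ?_) _
    by_cases ha : a.1 = direct N c
    · simp only [playing, decide_eq_true ha, ind_true, one_mul]
      rw [ha]
      exact sum_outcomeProb_mul_sub M _ _ _ (meanReward_eq_sum_outcomeProb M _).symm
    · refine Finset.sum_eq_zero fun o _ => ?_
      simp [playing, ha]

end Events

/-! ### Accuracy of the estimates on good histories. -/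

section GoodHistories

variable {N : ℕ} {𝒜 : Finset (Intervention N)} {h𝒜 : actionsNMC N ⊆ 𝒜} {T : ℕ} {M : Bandit N}
  {h : Fin T → Round 𝒜} {L : ℝ}

theorem sampleSize_pos (hN : 1 ≤ N) (hT : 0 < T) (s : Bool) : 0 < sampleSize M T s := by
  have := one_le_difficulty hN (M.armMean s)
  have := bern_pos M.α_mem s
  rw [sampleSize, Bandit.diff]
  positivity

/-- The arms that are not biased in context `s` are not rare at level `k`. -/
theorem rareSet_subset_biasedSet (hN : 1 ≤ N) {s : Bool} {k : ℕ} (hk : M.diff s ≤ k)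
    (hL : 90 * M.diff s * L ≤ bern M.α s * cnt (observed (T / 5)) h)
    (hL0 : 0 < L) (hg : ∀ j, score (family 𝒜 M T L j) h ≤ L) :
    rareSet (T / 5) s h k ⊆ biasedSet (M.armMean s) (M.diff s) := by
  intro n hn
  by_contra hnb
  simp only [rareSet, Finset.mem_filter, Finset.mem_univ, true_and] at hn
  obtain ⟨b, hb⟩ := hn
  have hD : 1 ≤ M.diff s := one_le_difficulty hN (M.armMean s)
  have hP := bern_pos M.α_mem s
  have hv := one_div_le_bern hnb b
  have hv0 := (bern_pos (M.armMean_mem s n) b).le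
  set K := cnt (observed (T / 5)) h with hK
  set P := bern M.α s with hPdef
  set v := bern (M.armMean s n) b with hvdef
  have hlow : 1 / 2 * (P * v * K) - L ≤ cnt (both (observed (T / 5)) (inCell s n b)) h :=
    cnt_lower_of_score_le (mul_nonneg hP.le hv0) (hg (.inr (.inl (s, n, b))))
  have hup : cnt (both (observed (T / 5)) (inContext s)) h ≤ 2 * (P * K) + L :=
    cnt_upper_of_score_le hP.le (hg (.inr (.inr (.inr (.inl (s, true))))))
  have hDv : 1 ≤ M.diff s * v := by
    rw [div_le_iff₀ (by linarith)] at hv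
    linarith
  set C := cnt (both (observed (T / 5)) (inCell s n b)) h with hC
  have hC0 : 0 ≤ C := cnt_nonneg _ _
  have hPK : 0 ≤ P * K := mul_nonneg hP.le (cnt_nonneg _ _)
  -- An unbiased value has conditional probability at least `1/D`, with `D = M.diff s`. The two
  -- count bounds lose a factor 2 each, so up to terms in `L` the context count is at most `4D`
  -- times the cell count. The 5 in `rareSet` leaves a surplus `P K / 2`, which exceeds the
  -- remaining `6 D L` by `hL`.
  have h1 : P * K ≤ M.diff s * (P * v * K) := by nlinarith
  have h2 : M.diff s * (1 / 2 * (P * v * K) - L) ≤ M.diff s * C :=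
    mul_le_mul_of_nonneg_left hlow (by linarith)
  have h3 : M.diff s * C ≤ k * C := mul_le_mul_of_nonneg_right hk hC0
  have h4 : L ≤ M.diff s * L := by nlinarith
  nlinarith

/-- The level `⌈D⌉`, `D` the difficulty, already qualifies: its rare arms are biased, and there are
at most `D` of those. No lower bound on the level is needed, since an arm that is not rare has been
observed often by definition. -/
theorem rareLevel_le (hN : 1 ≤ N) {s : Bool}
    (hL : 90 * M.diff s * L ≤ bern M.α s * cnt (observed (T / 5)) h)
    (hL0 : 0 < L) (hg : ∀ j, score (family 𝒜 M T L j) h ≤ L) :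
    (rareLevel (T / 5) s h : ℝ) ≤ 2 * M.diff s := by
  have hD : 1 ≤ M.diff s := one_le_difficulty hN (M.armMean s)
  have hc := Nat.le_ceil (M.diff s)
  have hle : rareLevel (T / 5) s h ≤ ⌈M.diff s⌉₊ := by
    refine Nat.find_min' _ ?_
    have h1 := Finset.card_le_card (rareSet_subset_biasedSet hN hc hL hL0 hg)
    have h2 := card_biasedSet_difficulty_le hN (M.armMean s)
    have : ((rareSet (T / 5) s h ⌈M.diff s⌉₊).card : ℝ) ≤ ⌈M.diff s⌉₊ :=
      (Nat.cast_le.2 h1).trans (h2.trans hc)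
    exact_mod_cast this
  have h1 : (rareLevel (T / 5) s h : ℝ) ≤ ⌈M.diff s⌉₊ := by exact_mod_cast hle
  linarith [Nat.ceil_lt_add_one (show 0 ≤ M.diff s by linarith)]

/-- Every effect of an arm is estimated from sufficiently many rounds. -/
theorem sampleSize_le_cnt_informative (hN : 1 ≤ N) (hT : (T : ℝ) ≤ 6 * (T / 5 : ℕ))
    (hL0 : 1 / 2 ≤ L) (hL : ∀ s, 540 * M.diff s * L ≤ bern M.α s * T)
    (hh : historyProb M (Algorithm.ofRule (rule h𝒜 T)) T h ≠ 0)
    (hg : ∀ j, score (family 𝒜 M T L j) h ≤ L) (s : Bool) (n : Fin N) (b : Bool) :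
    sampleSize M T s ≤ cnt (informative s n b) h := by
  have hD : 1 ≤ M.diff s := one_le_difficulty hN (M.armMean s)
  have hP := bern_pos M.α_mem s
  have hP1 : bern M.α s ≤ 1 := by
    have := M.α_mem.1
    have := M.α_mem.2
    cases s <;> simp [bern] <;> linarith
  have hKm := le_cnt_observed hh
  -- Here 540 = 6 · 90, with the 6 from `T ≤ 6 (T / 5)`.
  have hLm : 90 * M.diff s * L ≤ bern M.α s * (T / 5 : ℕ) := by
    have := mul_le_mul_of_nonneg_left hT hP.le
    linarith [hL s]
  have hLK := hLm.trans (mul_le_mul_of_nonneg_left hKm hP.le)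
  have hk := rareLevel_le hN hLK (by linarith) hg
  have hPT := mul_le_mul_of_nonneg_left hT hP.le
  rw [sampleSize, div_le_iff₀ (by linarith)]
  have hmono : ∀ B : ℕ → Round 𝒜 → Bool,
      (∀ i r, B i r = true → r.action.1 = .observe ∨ r.action.1 = .setArm n b) →
      cnt (both B (inCell s n b)) h ≤ cnt (informative s n b) h := by
    intro B hB
    refine cnt_mono (fun i r hr => ?_) h
    simp only [both, Bool.and_eq_true] at hr
    simp only [informative, hr.2, Bool.true_and, Bool.or_eq_true, decide_eq_true_eq]
    exact hB i r hr.1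
  set m : ℝ := ((T / 5 : ℕ) : ℝ) with hm
  set P := bern M.α s with hPdef
  set D := M.diff s with hDdef
  have hDL : L ≤ D * L := by nlinarith
  -- A rare arm is served by its share of the phase for context `s`, any other arm by the
  -- observational phase.
  by_cases hn : n ∈ rareSet (T / 5) s h (rareLevel (T / 5) s h)
  · have hp : (n, b) ∈ rarePairs (T / 5) s h := by simp [rarePairs, hn]
    have hA := le_cnt_playing_setArm hh hp
    set c := (rarePairs (T / 5) s h).card with hc
    have hcpos : 0 < c := Finset.card_pos.2 ⟨_, hp⟩
    -- Two values for each of at most `rareLevel ≤ 2 D` arms.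
    have hcle : (c : ℝ) ≤ 4 * D := by
      have h1 : c ≤ rareLevel (T / 5) s h * 2 := by
        rw [hc, rarePairs, Finset.card_product, Finset.card_univ, Fintype.card_bool]
        exact Nat.mul_le_mul_right _ (Nat.find_spec (exists_card_rareSet_le (T / 5) s h))
      have h2 : (c : ℝ) ≤ rareLevel (T / 5) s h * 2 := by exact_mod_cast h1
      linarith
    have hdiv : m ≤ c * ((T / 5 / c : ℕ) : ℝ) + c := by
      have h1 : T / 5 ≤ c * (T / 5 / c) + c := by
        have := Nat.div_add_mod (T / 5) c
        have := Nat.mod_lt (T / 5) hcpos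
        omega
      rw [hm]
      exact_mod_cast h1
    set A := cnt (playing (.setArm n b)) h with hAdef
    have hA0 : 0 ≤ A := cnt_nonneg _ _
    have hmA : m ≤ 4 * D * (A + 1) := by
      have h1 : (c : ℝ) * ((T / 5 / c : ℕ) : ℝ) ≤ c * A :=
        mul_le_mul_of_nonneg_left hA (Nat.cast_nonneg c)
      have h2 : (c : ℝ) * (A + 1) ≤ 4 * D * (A + 1) :=
        mul_le_mul_of_nonneg_right hcle (by linarith)
      linarith
    have hlow : 1 / 2 * (P * A) - L ≤
        cnt (both (playing (.setArm n b)) (inCell s n b)) h :=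
      cnt_lower_of_score_le hP.le (hg (.inr (.inr (.inl (s, n, b)))))
    have hle := hlow.trans (hmono _ fun i r hr => by
      right; simpa [playing] using hr)
    set I := cnt (informative s n b) h with hI
    have h1 : P * m ≤ 4 * D * (P * A) + 4 * D * P := by nlinarith
    have h2 : D * (1 / 2 * (P * A) - L) ≤ D * I := mul_le_mul_of_nonneg_left hle (by linarith)
    have h3 : D * P ≤ 2 * (D * L) := by nlinarith
    linarith
  · have hC : 1 * cnt (both (observed (T / 5)) (inContext s)) h ≤
        5 * (rareLevel (T / 5) s h : ℝ) * cnt (both (observed (T / 5)) (inCell s n b)) h := by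
      simp only [rareSet, Finset.mem_filter, Finset.mem_univ, true_and, not_exists, not_lt] at hn
      rw [one_mul]
      exact hn b
    have hlow : 1 / 2 * (P * cnt (observed (T / 5)) h) - L ≤
        cnt (both (observed (T / 5)) (inContext s)) h :=
      cnt_lower_of_score_le hP.le (hg (.inr (.inr (.inr (.inl (s, false))))))
    have hle := hmono (observed (T / 5)) fun i r hr => by
      left; simp only [observed, Bool.and_eq_true, decide_eq_true_eq] at hr; exact hr.2
    have hC0 := cnt_nonneg (both (observed (T / 5)) (inCell s n b)) h
    set C := cnt (both (observed (T / 5)) (inCell s n b)) h with hCdef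
    set I := cnt (informative s n b) h with hI
    have hPm := mul_le_mul_of_nonneg_left hKm hP.le
    have h1 : (rareLevel (T / 5) s h : ℝ) * C ≤ 2 * D * C := mul_le_mul_of_nonneg_right hk hC0
    have h2 : D * C ≤ D * I := mul_le_mul_of_nonneg_left hle (by linarith)
    -- Together `P m / 2 - L ≤ 10 D I`, and `L ≤ D L ≤ P m / 90`; hence `P T ≤ 6 P m < 123 D I`.
    -- This case dictates the 126 in `sampleSize`.
    linarith

theorem abs_estimate_direct_sub_le (c : Option Bool) (hT : 0 < T / 5) (hL0 : 0 < L)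
    (hh : historyProb M (Algorithm.ofRule (rule h𝒜 T)) T h ≠ 0)
    (hg : ∀ j, score (family 𝒜 M T L j) h ≤ L) (hc : direct N c ∈ 𝒜) :
    |estimate (T / 5) (direct N c) h - meanReward M (direct N c)| ≤
      Real.sqrt (2 * L / (T / 5 : ℕ)) := by
  have hcnt : ((T / 5 : ℕ) : ℝ) ≤ cnt (playing (direct N c)) h := by
    cases c
    · exact le_cnt_playing_observe hh
    · exact le_cnt_playing_setContext hh hc
  have hs : ∀ σ, score (meanFamily (playing (direct N c)) rewarded (meanReward M (direct N c))
      (sgn σ * Real.sqrt (2 * L / (T / 5 : ℕ)))) h ≤ L :=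
    fun σ => hg (.inr (.inr (.inr (.inr (.inr (c, σ))))))
  have key := abs_avg_sub_le hL0 (Nat.cast_pos.2 hT) hcnt hs
  have e : estimate (T / 5) (direct N c) h = avg (playing (direct N c)) rewarded h := by
    cases c <;> rfl
  rw [e]
  exact key

theorem abs_estimate_setArm_sub_le (hN : 1 ≤ N) (hT : (T : ℝ) ≤ 6 * (T / 5 : ℕ)) (hT0 : 0 < T / 5)
    (hL0 : 1 / 2 ≤ L) (hL : ∀ s, 540 * M.diff s * L ≤ bern M.α s * T)
    (hh : historyProb M (Algorithm.ofRule (rule h𝒜 T)) T h ≠ 0)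
    (hg : ∀ j, score (family 𝒜 M T L j) h ≤ L) (n : Fin N) (b : Bool) :
    |estimate (T / 5) (.setArm n b) h - meanReward M (.setArm n b)| ≤
      M.α * Real.sqrt (2 * L / sampleSize M T true) +
        (1 - M.α) * Real.sqrt (2 * L / sampleSize M T false) +
        Real.sqrt (2 * L / (T / 5 : ℕ)) := by
  have hLpos : 0 < L := by linarith
  have hs : ∀ s σ, score (meanFamily (informative s n b) rewarded (armValue M s n b)
      (sgn σ * Real.sqrt (2 * L / sampleSize M T s))) h ≤ L := fun s σ => hg (.inl ((s, n, b), σ))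
  have hsα : ∀ σ, score (meanFamily (observed (T / 5)) (inContext true) M.α
      (sgn σ * Real.sqrt (2 * L / (T / 5 : ℕ)))) h ≤ L :=
    fun σ => hg (.inr (.inr (.inr (.inr (.inl σ)))))
  have hcell := fun s => abs_avg_sub_le hLpos (sampleSize_pos (M := M) hN (by omega : 0 < T) s)
    (sampleSize_le_cnt_informative hN hT hL0 hL hh hg s n b) (hs s)
  have hα := abs_avg_sub_le hLpos (Nat.cast_pos.2 hT0) (le_cnt_observed hh) hsα
  have h1 := hcell true
  have h0 := hcell false
  have hr : meanReward M (.setArm n b) =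
      M.α * armValue M true n b + (1 - M.α) * armValue M false n b := by
    rw [meanReward_setArm, Fintype.sum_bool]
    simp [bern]
  rw [hr]
  simp only [estimate]
  have t1 := avg_nonneg (informative true n b) rewarded h
  have t1' := avg_le_one (informative true n b) rewarded h
  have t0 := avg_nonneg (informative false n b) rewarded h
  have t0' := avg_le_one (informative false n b) rewarded h
  set x1 := avg (informative true n b) rewarded h
  set x0 := avg (informative false n b) rewarded h
  set p := avg (observed (T / 5)) (inContext true) h
  -- The error of the estimated weight is multiplied by a difference of two averages in [0,1], so it
  -- is not amplified.
  have e : p * x1 + (1 - p) * x0 -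
      (M.α * armValue M true n b + (1 - M.α) * armValue M false n b) =
      M.α * (x1 - armValue M true n b) + (1 - M.α) * (x0 - armValue M false n b) +
        (p - M.α) * (x1 - x0) := by ring
  rw [e]
  have hα0 := M.α_mem.1.le
  have hα1 : 0 ≤ 1 - M.α := sub_nonneg.2 M.α_mem.2.le
  refine (abs_add_le _ _).trans (add_le_add ((abs_add_le _ _).trans (add_le_add ?_ ?_)) ?_)
  · rw [abs_mul, abs_of_nonneg hα0]
    exact mul_le_mul_of_nonneg_left h1 hα0
  · rw [abs_mul, abs_of_nonneg hα1]
    exact mul_le_mul_of_nonneg_left h0 hα1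
  · rw [abs_mul]
    refine (mul_le_of_le_one_right (abs_nonneg _) ?_).trans hα
    rw [abs_le]
    constructor <;> linarith

end GoodHistories

/-! ### Collecting the constants. -/

section Regret

variable {N : ℕ} {𝒜 : Finset (Intervention N)}

/-- The target rate dominates the errors of the estimates and the probability of failure. -/
theorem error_bounds {α D₁ D₀ L t m n : ℝ} (hα0 : 0 < α) (hα1 : 0 < 1 - α) (hD₁ : 1 ≤ D₁)
    (hD₀ : 1 ≤ D₀) (hL : 0.69 ≤ L) (ht : 700 < t) (hm : t ≤ 6 * m) (hn : 1 ≤ n) :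
    Real.sqrt (2 * L / m) ≤ 4 * Real.sqrt ((D₁ * α + D₀ * (1 - α)) * (L / t)) ∧
    α * Real.sqrt (2 * L / (α * t / (126 * D₁))) +
      (1 - α) * Real.sqrt (2 * L / ((1 - α) * t / (126 * D₀))) ≤
        23 * Real.sqrt ((D₁ * α + D₀ * (1 - α)) * (L / t)) ∧
    (16 * n + 12) * (1 / (n * t)) ≤ 2 * Real.sqrt ((D₁ * α + D₀ * (1 - α)) * (L / t)) := by
  have htpos : 0 < t := by linarith
  have hmpos : 0 < m := by linarith
  set S := Real.sqrt ((D₁ * α + D₀ * (1 - α)) * (L / t)) with hS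
  have hW : 1 ≤ D₁ * α + D₀ * (1 - α) := by nlinarith
  have hS0 : 0 ≤ S := Real.sqrt_nonneg _
  have hLT : 0 < L / t := by positivity
  have hS2 : S ^ 2 = (D₁ * α + D₀ * (1 - α)) * (L / t) := Real.sq_sqrt (by positivity)
  have hLTS : L / t ≤ S ^ 2 := by
    rw [hS2]
    exact le_mul_of_one_le_left hLT.le hW
  -- The weight `P` outside the root, once squared, beats the `1/P` inside: this gives `D P` instead
  -- of `D / P` in the rate.
  have hsq : ∀ P D : ℝ, 0 < P → 0 < D →
      (P * Real.sqrt (2 * L / (P * t / (126 * D)))) ^ 2 = 252 * (D * P * (L / t)) := by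
    intro P D hP hD
    rw [mul_pow, Real.sq_sqrt (by positivity)]
    field_simp
    ring
  -- The last bound passes through `28 / t`, because `16 n + 12 ≤ 28 n`.
  refine ⟨Real.sqrt_le_iff.2 ⟨by positivity, ?_⟩, le_of_sq_le_sq ?_ (by positivity),
    le_trans ?_ (le_of_sq_le_sq ?_ (by positivity) : 28 / t ≤ 2 * S)⟩
  · have h : 2 * L / m ≤ 12 * (L / t) := by
      rw [div_le_iff₀ hmpos, mul_div_assoc', div_mul_eq_mul_div, le_div_iff₀ htpos]
      nlinarith
    rw [mul_pow]
    linarith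
  · have h1 := hsq α D₁ hα0 (by linarith)
    have h0 := hsq (1 - α) D₀ hα1 (by linarith)
    set x := α * Real.sqrt (2 * L / (α * t / (126 * D₁)))
    set y := (1 - α) * Real.sqrt (2 * L / ((1 - α) * t / (126 * D₀)))
    -- Dropping the last square leaves the factor 504, below 23² = 529.
    have e : (x + y) ^ 2 = 2 * x ^ 2 + 2 * y ^ 2 - (x - y) ^ 2 := by ring
    rw [e, h1, h0, mul_pow]
    linarith [sq_nonneg (x - y), sq_nonneg S]
  · rw [mul_one_div, div_le_div_iff₀ (by positivity) htpos]
    nlinarith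
  · have h2 : (28 / t) ^ 2 ≤ 4 * (L / t) := by
      rw [div_pow, mul_div_assoc', div_le_div_iff₀ (by positivity) htpos]
      nlinarith
    rw [mul_pow]
    linarith

theorem simpleRegret_rule_le (h𝒜 : actionsNMC N ⊆ 𝒜) {T : ℕ} (hN : 1 ≤ N) (hT : 2 ≤ T)
    (M : Bandit N)
    (hM : 540 * max (difficulty M.p / M.α) (difficulty M.q / (1 - M.α)) *
      Real.log ((N : ℝ) * T) < (T : ℝ)) :
    simpleRegret M (Algorithm.ofRule (rule h𝒜 T)) T ≤
      56 * Real.sqrt ((difficulty M.p * M.α + difficulty M.q * (1 - M.α)) *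
        (Real.log ((N : ℝ) * T) / T)) := by
  classical
  set L := Real.log ((N : ℝ) * T) with hLdef
  have hN' : (1 : ℝ) ≤ N := by exact_mod_cast hN
  have hT' : (2 : ℝ) ≤ T := by exact_mod_cast hT
  have hNT : (2 : ℝ) ≤ N * T := by nlinarith
  have hL : 0.69 ≤ L := by
    have := Real.log_le_log (by norm_num) hNT
    linarith [Real.log_two_gt_d9]
  have hα0 := M.α_mem.1
  have hα1 : 0 < 1 - M.α := sub_pos.2 M.α_mem.2
  have hDp := one_le_difficulty hN M.p
  have hDq := one_le_difficulty hN M.q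
  have hLp : 540 * difficulty M.p * L < M.α * T := by
    have h1 := mul_le_mul_of_nonneg_right (le_max_left (difficulty M.p / M.α)
      (difficulty M.q / (1 - M.α))) (by linarith : 0 ≤ L)
    have h2 : difficulty M.p / M.α * (540 * L) < T := by linarith
    rw [div_mul_eq_mul_div, div_lt_iff₀ hα0] at h2
    linarith
  have hLq : 540 * difficulty M.q * L < (1 - M.α) * T := by
    have h1 := mul_le_mul_of_nonneg_right (le_max_right (difficulty M.p / M.α)
      (difficulty M.q / (1 - M.α))) (by linarith : 0 ≤ L)
    have h2 : difficulty M.q / (1 - M.α) * (540 * L) < T := by linarith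
    rw [div_mul_eq_mul_div, div_lt_iff₀ hα1] at h2
    linarith
  -- Adding `hLp` and `hLq` eliminates `α`, and 540 · 2 · 0.69 > 700.
  have hbig : (700 : ℝ) < T := by nlinarith
  have hbig' : 700 < T := by exact_mod_cast hbig
  have hm0 : 0 < T / 5 := by omega
  have hm : (T : ℝ) ≤ 6 * (T / 5 : ℕ) := by
    have : T ≤ 6 * (T / 5) := by omega
    exact_mod_cast this
  have hdt : M.diff true = difficulty M.p := rfl
  have hdf : M.diff false = difficulty M.q := rfl
  have hLs : ∀ s, 540 * M.diff s * L ≤ bern M.α s * T := by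
    intro s
    cases s
    · simpa [hdf, bern] using hLq.le
    · simpa [hdt, bern] using hLp.le
  obtain ⟨hdirect, hcells, hδ⟩ := error_bounds hα0 hα1 hDp hDq hL hbig hm hN'
  set S := Real.sqrt ((difficulty M.p * M.α + difficulty M.q * (1 - M.α)) * (L / T)) with hS
  have hS0 : 0 ≤ S := Real.sqrt_nonneg _
  have e1 : sampleSize M T true = M.α * T / (126 * difficulty M.p) := rfl
  have e0 : sampleSize M T false = (1 - M.α) * T / (126 * difficulty M.q) := rfl
  rw [← e1, ← e0] at hcells
  have hcard : (Fintype.card (EventIndex N) : ℝ) * Real.exp (-L) ≤ 2 * S := by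
    rw [card_eventIndex, Real.exp_neg, hLdef, Real.exp_log (by linarith), ← one_div]
    push_cast
    exact hδ
  have hest : ∀ h : Fin T → Round 𝒜, historyProb M (Algorithm.ofRule (rule h𝒜 T)) T h ≠ 0 →
      (∀ j, score (family 𝒜 M T L j) h ≤ L) →
      ∀ a : 𝒜, |estimate (T / 5) a h - meanReward M a| ≤ 27 * S := by
    rintro h hh hg ⟨a, ha⟩
    have hd : ∀ c, direct N c ∈ 𝒜 →
        |estimate (T / 5) (direct N c) h - meanReward M (direct N c)| ≤ 27 * S := fun c hc =>
      (abs_estimate_direct_sub_le c hm0 (by linarith) hh hg hc).trans (by linarith)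
    cases a with
    | observe => exact hd none ha
    | setContext s => exact hd (some s) ha
    | setArm n b =>
      exact (abs_estimate_setArm_sub_le hN hm hm0 (by linarith) hLs hh hg n b).trans
        (by linarith)
  have hbad := (sum_historyProb_bad_le (fun j => admissible_family M T L j)
    (Algorithm.ofRule (rule h𝒜 T)) T L (fun h => ∃ j, L < score (family 𝒜 M T L j) h)
    fun h hh => hh).trans hcard
  -- Comparing two estimates costs twice the error `27 S`, where 27 = 23 + 4.
  have hreg := simpleRegret_ofRule_le M (rule h𝒜 T) T
    (fun h => ∃ j, L < score (family 𝒜 M T L j) h) (54 * S) (2 * S) (by positivity) hbad ?_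
  · linarith
  intro h hh hgood a
  have hg : ∀ j, score (family 𝒜 M T L j) h ≤ L := fun j => not_lt.1 fun hj => hgood ⟨j, hj⟩
  have h1 := abs_le.1 (hest h hh hg a)
  have h2 := abs_le.1 (hest h hh hg (rule h𝒜 T T h))
  have h3 := estimate_le_estimate_rule h𝒜 T h a
  linarith [h1.1, h2.2]

end Regret

end HCB

end

theorem theorem1 (N T : ℕ) (hN : 1 ≤ N) (hT : 2 ≤ T) :
    (∃ φ : HCB.Algorithm (HCB.actionsNMC N), ∀ M : HCB.Bandit N,
      540 * max (HCB.difficulty M.p / M.α) (HCB.difficulty M.q / (1 - M.α)) *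
          Real.log ((N : ℝ) * T) < (T : ℝ) →
        HCB.simpleRegret M φ T ≤
          122 * Real.sqrt ((HCB.difficulty M.p * M.α + HCB.difficulty M.q * (1 - M.α)) *
            (Real.log ((N : ℝ) * T) / T))) ∧
    (∃ φ : HCB.Algorithm (HCB.actionsMC N), ∀ M : HCB.Bandit N,
      540 * max (HCB.difficulty M.p / M.α) (HCB.difficulty M.q / (1 - M.α)) *
          Real.log ((N : ℝ) * T) < (T : ℝ) →
        HCB.simpleRegret M φ T ≤
          116 * Real.sqrt ((HCB.difficulty M.p * M.α + HCB.difficulty M.q * (1 - M.α)) *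
            (Real.log ((N : ℝ) * T) / T))) := by
  -- The same rule works for both action sets, and its constant 56 is below 116 and 122.
  refine ⟨⟨HCB.Algorithm.ofRule (HCB.rule (Finset.Subset.refl _) T), fun M hM => ?_⟩,
    ⟨HCB.Algorithm.ofRule (HCB.rule Finset.subset_union_left T), fun M hM => ?_⟩⟩
  · refine (HCB.simpleRegret_rule_le _ hN hT M hM).trans ?_
    exact mul_le_mul_of_nonneg_right (by norm_num) (Real.sqrt_nonneg _)
  · refine (HCB.simpleRegret_rule_le _ hN hT M hM).trans ?_
    exact mul_le_mul_of_nonneg_right (by norm_num) (Real.sqrt_nonneg _)
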